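/- **Setting.** Let $\mathcal U,\mathcal Y$ be separable complex Hilbert spaces, $\mathbb C^+=\{\lambda\in\mathbb C:\operatorname{Re}\lambda>0\}$, and let $\varphi$ be a Schur function on $\mathbb C^+$, that is, a holomorphic function on $\mathbb C^+$ whose values are contractions $\mathcal U\to\mathcal Y$. Put $\widetilde\varphi(\mu)=\varphi(\overline\mu)^*$ and let $\mathcal H_c$ be the reproducing kernel Hilbert space of $\mathcal U$-valued functions on $\mathbb C^+$ with kernel $$K_c(\mu,\lambda)=\frac{1-\varphi(\overline\mu)^*\varphi(\overline\lambda)}{\mu+\overline\lambda};$$ write $e_c(\lambda)^*u=K_c(\cdot,\lambda)u$. Let $S_c:\mathcal H_c\oplus\mathcal U\supset\operatorname{dom}S_c\to\mathcal H_c\oplus\mathcal Y$ be the closure of the linear operator determined by $$(e_c(\overline\lambda)^*u,\,u)\mapsto(\lambda e_c(\overline\lambda)^*u,\ \varphi(\lambda)u),\qquad \lambda\in\mathbb C^+,\ u\in\mathcal U.$$ Its main operator $A_c$ and observation operator $C_c$ are given by $(A_cx,C_cx)=S_c(x,0)$ on $\operatorname{dom}A_c=\{x\in\mathcal H_c:(x,0)\in\operatorname{dom}S_c\}$.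 Let $A_c^*$ and $S_c^*$ be the Hilbert space adjoints; $S_c^*:\mathcal H_c\oplus\mathcal Y\supset\operatorname{dom}S_c^*\to\mathcal H_c\oplus\mathcal U$ is the dual system node. Fix $\beta\in\mathbb C^+$. Difference quotients below are understood with the removable singularity filled in by continuity. Let $\mathcal H^d_{c,-1}$ be the space of all functions $x:\mathbb C^+\to\mathcal U$ for which $\mu\mapsto\frac{x(\mu)-x(\overline\beta)}{\overline\beta-\mu}$ belongs to $\mathcal H_c$, modulo constant functions, with the norm $$\|[x]\|_{\mathcal H^d_{c,-1}}=\Bigl\|\mu\mapsto\frac{x(\mu)-x(\overline\beta)}{\overline\beta-\mu}\Bigr\|_{\mathcal H_c}.$$ **Theorem.** The space $\mathcal H^d_{c,-1}$ is complete, and the following hold. 1. The map $\iota:z\mapsto[z]$ is a continuous injection of $\mathcal H_c$ onto a dense subspace of $\mathcal H^d_{c,-1}$. Moreover $\overline\beta$ is in the resolvent set of $A_c^*$ and $\|\iota z\|_{\mathcal H^d_{c,-1}}=\|(\overline\beta-A_c^*)^{-1}z\|_{\mathcal H_c}$ for all $z\in\mathcal H_c$; thus $\mathcal H^d_{c,-1}$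 is a concrete realization of the extrapolation space of $A_c^*$, i.e. the completion of $\mathcal H_c$ in the latter norm. For every $[x]\in\mathcal H^d_{c,-1}$ and every $\alpha\in\mathbb C^+$ the function $\mu\mapsto\frac{x(\mu)-x(\overline\alpha)}{\overline\alpha-\mu}$ lies in $\mathcal H_c$, and $[x]\in\iota(\mathcal H_c)$ if and only if this function lies in $\operatorname{dom}A_c^*$ for some, equivalently for all, $\alpha\in\mathbb C^+$. In that case the representative $z\in\mathcal H_c$ of $[x]$ is the unique representative of $[x]$ satisfying $\lim_{\operatorname{Re}\eta\to\infty}z(\eta)=0$. 2. The formula $A_c^*|_{\mathcal H_c}x=[\mu\mapsto\mu x(\mu)]$, $x\in\mathcal H_c$, defines a bounded operator $\mathcal H_c\to\mathcal H^d_{c,-1}$. With $\mathcal H_c$ identified with $\iota(\mathcal H_c)$, it is the unique continuous extension of $A_c^*:\operatorname{dom}A_c^*\to\mathcal H_c$ to an operator $\mathcal H_c\to\mathcal H^d_{c,-1}$. For every $\alpha\in\mathbb C^+$ the operator $\overline\alpha-A_c^*|_{\mathcal H_c}:\mathcal H_c\to\mathcal H^d_{c,-1}$ has a bounded inverse, given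 by $$\bigl((\overline\alpha-A_c^*|_{\mathcal H_c})^{-1}[x]\bigr)(\mu)=\frac{x(\mu)-x(\overline\alpha)}{\overline\alpha-\mu},\qquad \mu\in\mathbb C^+,$$ and for $\alpha=\beta$ this inverse is a unitary map from $\mathcal H^d_{c,-1}$ onto $\mathcal H_c$. 3. The control operator $C_c^*:\mathcal Y\to\mathcal H^d_{c,-1}$ of the dual system node is bounded and given by $C_c^*y=[\mu\mapsto\widetilde\varphi(\mu)y]$. Here $C_c^*$ is characterized equivalently as (a) the unique bounded operator $B:\mathcal Y\to\mathcal H^d_{c,-1}$ such that $\operatorname{dom}S_c^*=\{(x,y)\in\mathcal H_c\oplus\mathcal Y:A_c^*|_{\mathcal H_c}x+By\in\iota(\mathcal H_c)\}$ and the first component of $S_c^*(x,y)$, embedded by $\iota$, equals $A_c^*|_{\mathcal H_c}x+By$ on this domain; (b) the unique bounded operator $B:\mathcal Y\to\mathcal H^d_{c,-1}$ that is the adjoint of $C_c$ with pivot space $\mathcal H_c$: for $y\in\mathcal Y$ and $x\in\operatorname{dom}A_c$, whenever $z_n\in\mathcal H_c$ and $\iota z_n\to By$ in $\mathcal H^d_{c,-1}$,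 then $\langle x,z_n\rangle_{\mathcal H_c}\to\langle C_cx,y\rangle_{\mathcal Y}$. -/

import Mathlib

open Complex Filter Topology Metric
open scoped ComplexConjugate InnerProductSpace

theorem DeBranges.disc_pos_aux {U Y ι : Type*} [NormedAddCommGroup U] [InnerProductSpace ℂ U]
    [NormedAddCommGroup Y] [InnerProductSpace ℂ Y] [CompleteSpace U] [CompleteSpace Y]
    (G : ℂ → U →L[ℂ] Y) (hG : ∀ z ∈ closedBall (0 : ℂ) 1, DifferentiableAt ℂ G z)
    (hn : ∀ z ∈ closedBall (0 : ℂ) 1, ‖G z‖ ≤ 1)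
    (s : Finset ι) (b : ι → ℂ) (hb : ∀ i, b i ∈ ball (0 : ℂ) 1) (v : ι → U) :
    0 ≤ (∑ i ∈ s, ∑ j ∈ s,
      (⟪v i, v j⟫_ℂ - ⟪G (b i) (v i), G (b j) (v j)⟫_ℂ) / (1 - b j * conj (b i))).re := by
  set h : ℂ → U := fun ζ => ∑ j ∈ s, (1 - b j * ζ)⁻¹ • v j with hh
  set k : ℂ → Y := fun ζ => ∑ j ∈ s, (1 - b j * ζ)⁻¹ • G (b j) (v j) with hk
  set F : ι → ℂ → ℂ := fun i ζ => ⟪v i, h ζ⟫_ℂ - 2 * ⟪G (conj ζ) (v i), k ζ⟫_ℂ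
    + ⟪G (b i) (v i), k ζ⟫_ℂ with hF
  have hne : ∀ i, ∀ ζ ∈ closedBall (0 : ℂ) 1, 1 - b i * ζ ≠ 0 := by
    intro i ζ hζ h0
    have h1 : ‖b i * ζ‖ = 1 := by
      rw [← sub_eq_zero.mp h0]; simp
    have h2 := hb i
    rw [mem_ball_zero_iff] at h2
    rw [mem_closedBall_zero_iff] at hζ
    rw [norm_mul] at h1
    nlinarith [norm_nonneg (b i), norm_nonneg ζ]
  have hinv : ∀ i, ∀ ζ ∈ closedBall (0 : ℂ) 1,
      DifferentiableAt ℂ (fun ζ => (1 - b i * ζ)⁻¹) ζ := by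
    intro i ζ hζ
    exact DifferentiableAt.inv (by fun_prop) (hne i ζ hζ)
  have hhd : ∀ ζ ∈ closedBall (0 : ℂ) 1, DifferentiableAt ℂ h ζ := by
    intro ζ hζ
    exact DifferentiableAt.fun_sum fun i _ => (hinv i ζ hζ).smul_const _
  have hkd : ∀ ζ ∈ closedBall (0 : ℂ) 1, DifferentiableAt ℂ k ζ := by
    intro ζ hζ
    exact DifferentiableAt.fun_sum fun i _ => (hinv i ζ hζ).smul_const _
  have hconjmem : ∀ ζ ∈ closedBall (0 : ℂ) 1, conj ζ ∈ closedBall (0 : ℂ) 1 := by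
    intro ζ hζ
    simpa [mem_closedBall_zero_iff] using hζ
  have hcross : ∀ (u : U) (y : Y), ∀ ζ ∈ closedBall (0 : ℂ) 1,
      DifferentiableAt ℂ (fun ζ => ⟪G (conj ζ) u, y⟫_ℂ) ζ := by
    intro u y ζ hζ
    have h1 : DifferentiableAt ℂ (fun w => ⟪y, G w u⟫_ℂ) (conj ζ) :=
      (innerSL ℂ y).differentiableAt.comp _
        ((hG _ (hconjmem ζ hζ)).clm_apply (differentiableAt_const u))
    have h2 := h1.conj_conj
    rw [Complex.conj_conj] at h2
    refine h2.congr_of_eventuallyEq (Eventually.of_forall fun w => ?_)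
    simp [Function.comp_def]
  have hFd : ∀ i, ∀ ζ ∈ closedBall (0 : ℂ) 1, DifferentiableAt ℂ (F i) ζ := by
    intro i ζ hζ
    have e : F i = fun ζ => ⟪v i, h ζ⟫_ℂ
        - 2 * (∑ j ∈ s, (1 - b j * ζ)⁻¹ * ⟪G (conj ζ) (v i), G (b j) (v j)⟫_ℂ)
        + ⟪G (b i) (v i), k ζ⟫_ℂ := by
      funext ζ
      simp only [hF, hk, inner_sum, inner_smul_right]
    rw [e]
    refine DifferentiableAt.add (DifferentiableAt.sub ?_ ?_) ?_
    · exact (innerSL ℂ (v i)).differentiableAt.comp _ (hhd ζ hζ)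
    · refine DifferentiableAt.const_mul (DifferentiableAt.fun_sum fun j _ => ?_) _
      exact (hinv j ζ hζ).mul (hcross _ _ ζ hζ)
    · exact (innerSL ℂ (G (b i) (v i))).differentiableAt.comp _ (hkd ζ hζ)
  have hmem : ∀ i, conj (b i) ∈ ball (0 : ℂ) |1| := by
    intro i
    simpa [mem_ball_zero_iff] using hb i
  have havg : ∀ i, Real.circleAverage (fun z => ((z - 0) / (z - conj (b i))) • F i z) 0 1
      = F i (conj (b i)) := by
    intro i
    refine DiffContOnCl.circleAverage_smul_div ?_ (hmem i)
    rw [abs_one]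
    refine ⟨fun z hz => (hFd i z (ball_subset_closedBall hz)).differentiableWithinAt, ?_⟩
    rw [closure_ball _ one_ne_zero]
    exact fun z hz => (hFd i z hz).continuousAt.continuousWithinAt
  have hzne : ∀ i, ∀ z ∈ sphere (0 : ℂ) 1, z - conj (b i) ≠ 0 := by
    intro i z hz h0
    have := hmem i
    rw [← sub_eq_zero.mp h0] at this
    simp at this hz
    linarith
  have hint : ∀ i ∈ s, CircleIntegrable (fun z => ((z - 0) / (z - conj (b i))) • F i z) 0 1 := by
    intro i _
    refine ContinuousOn.circleIntegrable zero_le_one fun z hz => ?_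
    refine ContinuousAt.continuousWithinAt (ContinuousAt.fun_smul ?_ ?_)
    · exact ContinuousAt.div (by fun_prop) (by fun_prop) (hzne i z hz)
    · exact (hFd i z (sphere_subset_closedBall hz)).continuousAt
  have hsum := Real.circleAverage_sum hint
  have hval : (∑ i ∈ s, ∑ j ∈ s,
      (⟪v i, v j⟫_ℂ - ⟪G (b i) (v i), G (b j) (v j)⟫_ℂ) / (1 - b j * conj (b i)))
      = Real.circleAverage (∑ i ∈ s, fun z => ((z - 0) / (z - conj (b i))) • F i z) 0 1 := by
    rw [hsum]
    refine Finset.sum_congr rfl fun i _ => ?_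
    rw [havg]
    simp only [hF, hh, hk, Complex.conj_conj, inner_sum, inner_smul_right, Finset.mul_sum]
    rw [← Finset.sum_sub_distrib, ← Finset.sum_add_distrib]
    refine Finset.sum_congr rfl fun j _ => ?_
    ring
  rw [hval]
  have hci : CircleIntegrable (∑ i ∈ s, fun z => ((z - 0) / (z - conj (b i))) • F i z) 0 1 :=
    CircleIntegrable.sum s hint
  have hre := Complex.reCLM.circleAverage_comp_comm hci
  refine le_of_le_of_eq ?_ hre
  refine Real.circleAverage_nonneg_of_nonneg fun z hz => ?_
  rw [abs_one] at hz
  have hzc := sphere_subset_closedBall hz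
  have hz1 : z * conj z = 1 := by
    rw [Complex.mul_conj, Complex.normSq_eq_norm_sq]
    rw [mem_sphere_zero_iff_norm] at hz
    simp [hz]
  have hcoef : ∀ i, (z - 0) / (z - conj (b i)) = conj ((1 - b i * z)⁻¹) := by
    intro i
    rw [div_eq_iff (hzne i z hz), map_inv₀, eq_inv_mul_iff_mul_eq₀]
    · simp only [map_sub, map_one, map_mul]
      linear_combination (-conj (b i)) * hz1
    · rw [Ne, map_eq_zero]
      exact hne i z hzc
  have e1 : (∑ i ∈ s, fun z => ((z - 0) / (z - conj (b i))) • F i z) z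
      = ⟪h z, h z⟫_ℂ - 2 * ⟪h z, (G (conj z)).adjoint (k z)⟫_ℂ + ⟪k z, k z⟫_ℂ := by
    rw [Finset.sum_apply]
    simp only [hcoef]
    have a1 : ⟪h z, h z⟫_ℂ = ∑ i ∈ s, conj ((1 - b i * z)⁻¹) * ⟪v i, h z⟫_ℂ := by
      conv_lhs => rw [hh]
      simp only [sum_inner, inner_smul_left]
      rfl
    have a2 : ⟪k z, k z⟫_ℂ = ∑ i ∈ s, conj ((1 - b i * z)⁻¹) * ⟪G (b i) (v i), k z⟫_ℂ := by
      conv_lhs => rw [hk]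
      simp only [sum_inner, inner_smul_left]
      rfl
    have a3 : ⟪h z, (G (conj z)).adjoint (k z)⟫_ℂ
        = ∑ i ∈ s, conj ((1 - b i * z)⁻¹) * ⟪G (conj z) (v i), k z⟫_ℂ := by
      rw [ContinuousLinearMap.adjoint_inner_right]
      conv_lhs => rw [hh]
      simp only [map_sum, map_smul, sum_inner, inner_smul_left]
    rw [a1, a2, a3, Finset.mul_sum, ← Finset.sum_sub_distrib, ← Finset.sum_add_distrib]
    refine Finset.sum_congr rfl fun i _ => ?_
    simp only [hF, smul_eq_mul]
    ring
  change 0 ≤ ((∑ i ∈ s, fun z => ((z - 0) / (z - conj (b i))) • F i z) z).re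
  rw [e1]
  set q := (G (conj z)).adjoint (k z) with hq
  have hqk : ‖q‖ ≤ ‖k z‖ := by
    refine (ContinuousLinearMap.le_opNorm _ _).trans ?_
    rw [LinearIsometryEquiv.norm_map]
    exact mul_le_of_le_one_left (norm_nonneg _) (hn _ (hconjmem z hzc))
  have h3 : (⟪h z, h z⟫_ℂ - 2 * ⟪h z, q⟫_ℂ + ⟪k z, k z⟫_ℂ).re
      = ‖h z‖ ^ 2 - 2 * (⟪h z, q⟫_ℂ).re + ‖k z‖ ^ 2 := by
    rw [inner_self_eq_norm_sq_to_K, inner_self_eq_norm_sq_to_K]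
    simp [← Complex.ofReal_pow]
  rw [h3]
  have h4 := norm_sub_sq (𝕜 := ℂ) (h z) q
  simp only [RCLike.re_to_complex] at h4
  nlinarith [sq_nonneg ‖h z - q‖, norm_nonneg q]

theorem DeBranges.disc_pos {U Y ι : Type*} [NormedAddCommGroup U] [InnerProductSpace ℂ U]
    [NormedAddCommGroup Y] [InnerProductSpace ℂ Y] [CompleteSpace U] [CompleteSpace Y]
    (G : ℂ → U →L[ℂ] Y) (hG : ∀ z ∈ ball (0 : ℂ) 1, DifferentiableAt ℂ G z)
    (hn : ∀ z ∈ ball (0 : ℂ) 1, ‖G z‖ ≤ 1)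
    (s : Finset ι) (b : ι → ℂ) (hb : ∀ i, b i ∈ ball (0 : ℂ) 1) (v : ι → U) :
    0 ≤ (∑ i ∈ s, ∑ j ∈ s,
      (⟪v i, v j⟫_ℂ - ⟪G (b i) (v i), G (b j) (v j)⟫_ℂ) / (1 - b j * conj (b i))).re := by
  have hev : ∀ᶠ r : ℝ in 𝓝[<] 1, 0 ≤ (∑ i ∈ s, ∑ j ∈ s,
      (⟪v i, v j⟫_ℂ - ⟪G (r * b i) (v i), G (r * b j) (v j)⟫_ℂ) / (1 - b j * conj (b i))).re := by
    filter_upwards [Ioo_mem_nhdsLT (zero_lt_one' ℝ)] with r hr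
    have hm : ∀ z ∈ closedBall (0 : ℂ) 1, (r : ℂ) * z ∈ ball (0 : ℂ) 1 := by
      intro z hz
      rw [mem_closedBall_zero_iff] at hz
      rw [mem_ball_zero_iff, norm_mul, Complex.norm_real, Real.norm_of_nonneg hr.1.le]
      nlinarith [hr.1, hr.2, norm_nonneg z]
    exact DeBranges.disc_pos_aux (fun z => G (r * z))
      (fun z hz => (hG _ (hm z hz)).comp z (by fun_prop))
      (fun z hz => hn _ (hm z hz)) s b hb v
  have hc : ∀ i, Tendsto (fun r : ℝ => G (r * b i) (v i)) (𝓝[<] 1) (𝓝 (G (b i) (v i))) := by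
    intro i
    have h1 : ContinuousAt (fun r : ℝ => G (r * b i) (v i)) 1 := by
      have h2 : ContinuousAt G (((1 : ℝ) : ℂ) * b i) := by
        simpa using (hG _ (hb i)).continuousAt
      have h3 : ContinuousAt (fun r : ℝ => G (r * b i)) 1 :=
        ContinuousAt.comp (f := fun r : ℝ => (r : ℂ) * b i) h2 (by fun_prop)
      exact h3.clm_apply continuousAt_const
    have := h1.tendsto.mono_left (nhdsWithin_le_nhds (s := Set.Iio 1))
    simpa using this
  have hlim := Tendsto.comp Complex.continuous_re.continuousAt.tendsto
    (tendsto_finsetSum s fun i _ => tendsto_finsetSum s fun j _ =>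
      ((tendsto_const_nhds (x := ⟪v i, v j⟫_ℂ)).sub ((hc i).inner (𝕜 := ℂ) (hc j))).div_const
        (1 - b j * conj (b i)))
  exact ge_of_tendsto hlim hev

namespace DeBranges

/-- The open right half-plane. -/
abbrev CPlus : Type := {z : ℂ // 0 < z.re}

/-- Complex conjugation on the right half-plane. -/
def CPlus.bar (z : CPlus) : CPlus := ⟨conj (z : ℂ), by simpa using z.2⟩

theorem CPlus.coe_bar (z : CPlus) : (z.bar : ℂ) = conj (z : ℂ) := rfl

theorem CPlus.bar_bar (z : CPlus) : z.bar.bar = z := Subtype.ext (by simp [CPlus.coe_bar])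

theorem CPlus.add_conj_ne_zero (μ l : CPlus) : (μ : ℂ) + conj (l : ℂ) ≠ 0 := by
  intro h
  have h1 := congrArg Complex.re h
  have h2 := μ.2
  have h3 := l.2
  simp at h1
  linarith

/-- The Schur class over the right half-plane: holomorphic functions on the right half-plane whose
values are contractions from `U` to `Y`.  (Values outside the half-plane are irrelevant.) -/
structure SchurFunction (U Y : Type*) [NormedAddCommGroup U] [InnerProductSpace ℂ U]
    [NormedAddCommGroup Y] [InnerProductSpace ℂ Y] where
  toFun : ℂ → U →L[ℂ] Y
  differentiableOn : DifferentiableOn ℂ toFun {z : ℂ | 0 < z.re}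
  norm_le_one : ∀ z : ℂ, 0 < z.re → ‖toFun z‖ ≤ 1

section Model

variable {U Y : Type*} [NormedAddCommGroup U] [InnerProductSpace ℂ U] [CompleteSpace U]
  [NormedAddCommGroup Y] [InnerProductSpace ℂ Y] [CompleteSpace Y]

/-- The function `φ̃(μ) = φ(conj μ)^*`. -/
noncomputable def SchurFunction.tilde (φ : SchurFunction U Y) (μ : CPlus) : Y →L[ℂ] U :=
  (φ.toFun μ.bar).adjoint

/-- The kernel `K_c(μ, l) = (1 - φ(conj μ)^* φ(conj l)) / (μ + conj l)`. -/
noncomputable def kernelC (φ : SchurFunction U Y) : Matrix CPlus CPlus (U →L[ℂ] U) :=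
  Matrix.of fun μ l => ((μ : ℂ) + conj (l : ℂ))⁻¹ •
    (ContinuousLinearMap.id ℂ U - (φ.toFun μ.bar).adjoint ∘L φ.toFun l.bar)

theorem inner_kernelC (φ : SchurFunction U Y) (μ l : CPlus) (u v : U) :
    ⟪kernelC φ μ l u, v⟫_ℂ = (conj (μ : ℂ) + l)⁻¹ *
      (⟪u, v⟫_ℂ - ⟪φ.toFun l.bar u, φ.toFun μ.bar v⟫_ℂ) := by
  simp [kernelC, ContinuousLinearMap.adjoint_inner_left, inner_smul_left, inner_sub_left, mul_comm]

theorem isHermitian_kernelC (φ : SchurFunction U Y) : (kernelC φ).IsHermitian := by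
  ext μ l u
  refine ext_inner_right ℂ fun v => ?_
  rw [inner_kernelC, Matrix.conjTranspose_apply, ContinuousLinearMap.star_eq_adjoint,
    ContinuousLinearMap.adjoint_inner_left, ← inner_conj_symm, inner_kernelC]
  simp only [map_mul, map_inv₀, map_add, map_sub, inner_conj_symm, Complex.conj_conj]
  rw [add_comm]

/-- `K_c` is a positive kernel. -/
theorem posSemidef_kernelC (φ : SchurFunction U Y) : (kernelC φ).PosSemidef := by
  have htfae := (RKHS.posSemidef_tfae (K := kernelC φ)).out 0 2
  refine htfae.mpr ⟨isHermitian_kernelC φ, fun w => ?_⟩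
  have hone : ∀ z ∈ ball (0 : ℂ) 1, 1 - z ≠ 0 := by
    intro z hz h0
    rw [mem_ball_zero_iff, ← sub_eq_zero.mp h0] at hz
    simp at hz
  have hre : ∀ z ∈ ball (0 : ℂ) 1, 0 < ((1 + z) / (1 - z)).re := by
    intro z hz
    have h1 : 0 < Complex.normSq (1 - z) := Complex.normSq_pos.mpr (hone z hz)
    rw [mem_ball_zero_iff] at hz
    have h2 : Complex.normSq z < 1 := by
      rw [Complex.normSq_eq_norm_sq]
      nlinarith [norm_nonneg z]
    rw [Complex.div_re, ← add_div]
    apply div_pos _ h1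
    rw [Complex.normSq_apply] at h2
    simp
    nlinarith
  have hopen : IsOpen {z : ℂ | 0 < z.re} := isOpen_lt continuous_const Complex.continuous_re
  have hb : ∀ x : CPlus, (conj (x : ℂ) - 1) / (conj (x : ℂ) + 1) ∈ ball (0 : ℂ) 1 := by
    intro x
    have hx := x.2
    have h1 : 0 < ‖conj (x : ℂ) + 1‖ := by
      rw [norm_pos_iff]
      intro h0
      have := congrArg Complex.re h0
      simp at this
      linarith
    rw [mem_ball_zero_iff, norm_div, div_lt_one h1]
    refine lt_of_pow_lt_pow_left₀ 2 (norm_nonneg _) ?_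
    rw [← Complex.normSq_eq_norm_sq, ← Complex.normSq_eq_norm_sq, Complex.normSq_apply,
      Complex.normSq_apply]
    simp
    nlinarith
  have hp : ∀ x : CPlus, conj (x : ℂ) + 1 ≠ 0 := by
    intro x h0
    have := congrArg Complex.re h0
    have hx := x.2
    simp at this
    linarith
  have hp' : ∀ x : CPlus, (x : ℂ) + 1 ≠ 0 := by
    intro x h0
    have := congrArg Complex.re h0
    have hx := x.2
    simp at this
    linarith
  have hcay : ∀ x : CPlus, (1 + (conj (x : ℂ) - 1) / (conj (x : ℂ) + 1)) /
      (1 - (conj (x : ℂ) - 1) / (conj (x : ℂ) + 1)) = conj (x : ℂ) := by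
    intro x
    have h1 := hp x
    have h2 : 1 - (conj (x : ℂ) - 1) / (conj (x : ℂ) + 1) = 2 / (conj (x : ℂ) + 1) := by
      field_simp
      ring
    rw [h2]
    field_simp
    ring
  have key := disc_pos (fun z => φ.toFun ((1 + z) / (1 - z)))
    (fun z hz => (φ.differentiableOn.differentiableAt (hopen.mem_nhds (hre z hz))).comp z
      (DifferentiableAt.div (by fun_prop) (by fun_prop) (hone z hz)))
    (fun z hz => φ.norm_le_one _ (hre z hz)) w.support
    (fun x : CPlus => (conj (x : ℂ) - 1) / (conj (x : ℂ) + 1)) hb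
    (fun x => (conj (x : ℂ) + 1)⁻¹ • w x)
  have heq : (w.sum fun x a => w.sum fun x' a' => ⟪kernelC φ x' x a, a'⟫_ℂ)
      = 2 * ∑ i ∈ w.support, ∑ j ∈ w.support,
        (⟪(conj (i : ℂ) + 1)⁻¹ • w i, (conj (j : ℂ) + 1)⁻¹ • w j⟫_ℂ -
          ⟪φ.toFun ((1 + (conj (i : ℂ) - 1) / (conj (i : ℂ) + 1)) /
            (1 - (conj (i : ℂ) - 1) / (conj (i : ℂ) + 1))) ((conj (i : ℂ) + 1)⁻¹ • w i),
          φ.toFun ((1 + (conj (j : ℂ) - 1) / (conj (j : ℂ) + 1)) /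
            (1 - (conj (j : ℂ) - 1) / (conj (j : ℂ) + 1))) ((conj (j : ℂ) + 1)⁻¹ • w j)⟫_ℂ) /
        (1 - (conj (j : ℂ) - 1) / (conj (j : ℂ) + 1) *
          conj ((conj (i : ℂ) - 1) / (conj (i : ℂ) + 1))) := by
    simp only [Finsupp.sum, Finset.mul_sum]
    refine Finset.sum_congr rfl fun i _ => Finset.sum_congr rfl fun j _ => ?_
    rw [inner_kernelC, hcay, hcay]
    simp only [map_smul, inner_smul_left, inner_smul_right, map_inv₀, map_add, map_sub, map_one,
      map_div₀, Complex.conj_conj, CPlus.coe_bar]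
    have h1 := hp j
    have h2 := hp' i
    have h3 : conj (j : ℂ) + (i : ℂ) ≠ 0 := by
      rw [add_comm]
      exact CPlus.add_conj_ne_zero i j
    have h4 : 1 - (conj (j : ℂ) - 1) / (conj (j : ℂ) + 1) * (((i : ℂ) - 1) / ((i : ℂ) + 1))
        = 2 * (conj (j : ℂ) + i) / ((conj (j : ℂ) + 1) * ((i : ℂ) + 1)) := by
      field_simp
      ring
    rw [h4]
    field_simp
  rw [heq]
  simpa using key

instance (φ : SchurFunction U Y) : Fact (kernelC φ).PosSemidef := ⟨posSemidef_kernelC φ⟩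

/-- The de Branges-Rovnyak space `H_c`: the reproducing kernel Hilbert space of functions from the
right half-plane to `U` whose reproducing kernel is `K_c`. -/
def Hc (φ : SchurFunction U Y) : Type _ := RKHS.OfKernel (kernelC φ)

noncomputable instance (φ : SchurFunction U Y) : NormedAddCommGroup (Hc φ) :=
  inferInstanceAs (NormedAddCommGroup (RKHS.OfKernel (kernelC φ)))

noncomputable instance (φ : SchurFunction U Y) : InnerProductSpace ℂ (Hc φ) :=
  inferInstanceAs (InnerProductSpace ℂ (RKHS.OfKernel (kernelC φ)))

instance (φ : SchurFunction U Y) : CompleteSpace (Hc φ) :=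
  inferInstanceAs (CompleteSpace (RKHS.OfKernel (kernelC φ)))

noncomputable instance (φ : SchurFunction U Y) : RKHS ℂ (Hc φ) CPlus U :=
  inferInstanceAs (RKHS ℂ (RKHS.OfKernel (kernelC φ)) CPlus U)

theorem kernel_Hc (φ : SchurFunction U Y) : RKHS.kernel (Hc φ) = kernelC φ :=
  RKHS.OfKernel.kernel_ofKernel (K := kernelC φ)

/-- The kernel function `e_c(l)^* u = K_c(·, l) u`, an element of `H_c`. -/
noncomputable def kerC (φ : SchurFunction U Y) (l : CPlus) (u : U) : Hc φ :=
  RKHS.kerFun (Hc φ) l u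

theorem kerC_apply (φ : SchurFunction U Y) (l : CPlus) (u : U) (μ : CPlus) :
    kerC φ l u μ = kernelC φ μ l u := by
  rw [kerC, RKHS.kerFun_apply, kernel_Hc]




/-- Elements of `H_c` that satisfy `(a - μ) h(μ) = 0` for all `μ` vanish. -/
theorem Hc_eq_zero (φ : SchurFunction U Y) (a : CPlus) (h : Hc φ)
    (hh : ∀ μ : CPlus, ((a : ℂ) - μ) • h μ = 0) : h = 0 := by
  have hoff : ∀ μ : CPlus, μ ≠ a → h μ = 0 := by
    intro μ hμ
    refine (smul_eq_zero.mp (hh μ)).resolve_left fun h0 => hμ ?_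
    exact Subtype.ext (sub_eq_zero.mp h0).symm
  ext μ
  rw [RKHS.coe_zero, Pi.zero_apply]
  by_cases hμ : μ = a
  swap
  · exact hoff μ hμ
  subst hμ
  refine ext_inner_left ℂ fun u => ?_
  rw [inner_zero_right]
  let p : ℝ → CPlus := fun t => ⟨(μ : ℂ) + (|t| : ℝ), by
    have := μ.2
    have := abs_nonneg t
    simp
    linarith⟩
  have hp0 : p 0 = μ := Subtype.ext (by simp [p])
  have hφ : ContinuousAt (fun t : ℝ => φ.toFun (p t).bar u) 0 := by
    have hopen : IsOpen {z : ℂ | 0 < z.re} := isOpen_lt continuous_const Complex.continuous_re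
    have h1 : ContinuousAt φ.toFun (((p 0).bar : CPlus) : ℂ) :=
      (φ.differentiableOn.differentiableAt (hopen.mem_nhds (p 0).bar.2)).continuousAt
    have h2 : Continuous fun t : ℝ => (((p t).bar : CPlus) : ℂ) := by
      simp only [CPlus.coe_bar, p]
      fun_prop
    have h3 := ContinuousAt.comp (f := fun t : ℝ => (((p t).bar : CPlus) : ℂ)) h1 h2.continuousAt
    exact h3.clm_apply continuousAt_const
  have hcoe : Continuous fun t : ℝ => ((p t : CPlus) : ℂ) := by
    simp only [p]
    fun_prop
  have hker : Tendsto (fun t : ℝ => kerC φ (p t) u) (𝓝 0) (𝓝 (kerC φ (p 0) u)) := by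
    rw [tendsto_iff_norm_sub_tendsto_zero]
    have hin : ∀ l m : CPlus, ⟪kerC φ l u, kerC φ m u⟫_ℂ = (conj (m : ℂ) + l)⁻¹ *
      (⟪u, u⟫_ℂ - ⟪φ.toFun l.bar u, φ.toFun m.bar u⟫_ℂ) := by
      intro l m
      rw [kerC, kerC, ← RKHS.kernel_inner, kernel_Hc, inner_kernelC]
    have hne : ∀ l m : CPlus, conj (m : ℂ) + l ≠ 0 := by
      intro l m
      rw [add_comm]
      exact CPlus.add_conj_ne_zero l m
    have hcont : ContinuousAt (fun t : ℝ => ⟪kerC φ (p t) u, kerC φ (p t) u⟫_ℂ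
        - ⟪kerC φ (p t) u, kerC φ (p 0) u⟫_ℂ - ⟪kerC φ (p 0) u, kerC φ (p t) u⟫_ℂ
        + ⟪kerC φ (p 0) u, kerC φ (p 0) u⟫_ℂ) 0 := by
      simp only [hin]
      refine ContinuousAt.add (ContinuousAt.sub (ContinuousAt.sub ?_ ?_) ?_) continuousAt_const
      · exact ContinuousAt.mul (ContinuousAt.inv₀ (by fun_prop) (hne _ _))
          (continuousAt_const.sub (hφ.inner (𝕜 := ℂ) hφ))
      · exact ContinuousAt.mul (ContinuousAt.inv₀ (by fun_prop) (hne _ _))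
          (continuousAt_const.sub (hφ.inner (𝕜 := ℂ) continuousAt_const))
      · exact ContinuousAt.mul (ContinuousAt.inv₀ (by fun_prop) (hne _ _))
          (continuousAt_const.sub (continuousAt_const.inner (𝕜 := ℂ) hφ))
    have hlim := (Complex.continuous_re.continuousAt.comp hcont).tendsto
    have hsq : ∀ t : ℝ, ‖kerC φ (p t) u - kerC φ (p 0) u‖
        = √(⟪kerC φ (p t) u, kerC φ (p t) u⟫_ℂ
        - ⟪kerC φ (p t) u, kerC φ (p 0) u⟫_ℂ - ⟪kerC φ (p 0) u, kerC φ (p t) u⟫_ℂ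
        + ⟪kerC φ (p 0) u, kerC φ (p 0) u⟫_ℂ).re := by
      intro t
      rw [← inner_sub_sub_self, norm_eq_sqrt_re_inner (𝕜 := ℂ)]
      rfl
    simp only [hsq]
    have := (Real.continuous_sqrt.tendsto _).comp hlim
    simpa [Function.comp_def] using this
  have h1 : Tendsto (fun t : ℝ => ⟪kerC φ (p t) u, h⟫_ℂ) (𝓝[>] 0) (𝓝 ⟪kerC φ (p 0) u, h⟫_ℂ) :=
    (hker.inner tendsto_const_nhds).mono_left nhdsWithin_le_nhds
  have h2 : Tendsto (fun t : ℝ => ⟪kerC φ (p t) u, h⟫_ℂ) (𝓝[>] 0) (𝓝 0) := by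
    refine tendsto_const_nhds.congr' ?_
    filter_upwards [self_mem_nhdsWithin] with t ht
    have ht' : (0 : ℝ) < t := ht
    rw [kerC, RKHS.kerFun_inner, hoff, inner_zero_right]
    intro h0
    have := congrArg (fun z : CPlus => (z : ℂ)) h0
    simp only [p, add_eq_left, Complex.ofReal_eq_zero, abs_eq_zero] at this
    exact ht'.ne' this
  have h3 := tendsto_nhds_unique h1 h2
  rwa [kerC, RKHS.kerFun_inner, hp0] at h3

/-- `h ∈ H_c` is the difference quotient `μ ↦ (x(μ) - x(a)) / (a - μ)` of `x` at `a`.  The removable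
singularity at `μ = a` is filled by the (unique) continuous value `h(a)`. -/
def IsDiffQuot (φ : SchurFunction U Y) (a : CPlus) (x : CPlus → U) (h : Hc φ) : Prop :=
  ∀ μ : CPlus, ((a : ℂ) - μ) • h μ = x μ - x a

theorem isDiffQuot_iff (φ : SchurFunction U Y) (a : CPlus) (x : CPlus → U) (h : Hc φ) :
    IsDiffQuot φ a x h ↔ ∀ μ : CPlus, μ ≠ a → h μ = ((a : ℂ) - μ)⁻¹ • (x μ - x a) := by
  refine forall_congr' fun μ => ?_
  by_cases hμ : μ = a
  · simp [hμ]
  · have h0 : (a : ℂ) - μ ≠ 0 := fun h0 => hμ (Subtype.ext (sub_eq_zero.mp h0).symm)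
    simp only [ne_eq, hμ, not_false_eq_true, forall_const]
    exact (eq_inv_smul_iff₀ h0).symm

theorem IsDiffQuot.unique {φ : SchurFunction U Y} {a : CPlus} {x : CPlus → U} {h h' : Hc φ}
    (hh : IsDiffQuot φ a x h) (hh' : IsDiffQuot φ a x h') : h = h' := by
  refine sub_eq_zero.mp (Hc_eq_zero φ a _ fun μ => ?_)
  rw [RKHS.coe_sub, Pi.sub_apply, smul_sub, hh μ, hh' μ, sub_self]

/-- The functions `x` from the right half-plane to `U` whose difference quotient
`μ ↦ (x(μ) - x(conj β)) / (conj β - μ)` belongs to `H_c`. -/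
def preExtrapolation (φ : SchurFunction U Y) (β : CPlus) : Submodule ℂ (CPlus → U) where
  carrier := {x | ∃ h : Hc φ, IsDiffQuot φ β.bar x h}
  zero_mem' := ⟨0, fun μ => by simp⟩
  add_mem' := by
    rintro x x' ⟨h, hh⟩ ⟨h', hh'⟩
    refine ⟨h + h', fun μ => ?_⟩
    rw [RKHS.coe_add, Pi.add_apply, smul_add, hh μ, hh' μ, Pi.add_apply, Pi.add_apply]
    abel
  smul_mem' := by
    rintro c x ⟨h, hh⟩
    refine ⟨c • h, fun μ => ?_⟩
    rw [RKHS.coe_smul, Pi.smul_apply, smul_comm, hh μ, smul_sub, Pi.smul_apply, Pi.smul_apply]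

/-- The map sending `x` to its difference quotient at `conj β`, an element of `H_c`. -/
noncomputable def diffQuot (φ : SchurFunction U Y) (β : CPlus) :
    preExtrapolation φ β →ₗ[ℂ] Hc φ where
  toFun x := x.2.choose
  map_add' x x' := by
    refine IsDiffQuot.unique (x + x').2.choose_spec fun μ => ?_
    rw [RKHS.coe_add, Pi.add_apply, smul_add, x.2.choose_spec μ, x'.2.choose_spec μ,
      Submodule.coe_add, Pi.add_apply, Pi.add_apply]
    abel
  map_smul' c x := by
    refine IsDiffQuot.unique (c • x).2.choose_spec fun μ => ?_
    rw [RingHom.id_apply, RKHS.coe_smul, Pi.smul_apply, smul_comm, x.2.choose_spec μ, smul_sub,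
      Submodule.coe_smul, Pi.smul_apply, Pi.smul_apply]

theorem isDiffQuot_diffQuot (φ : SchurFunction U Y) (β : CPlus) (x : preExtrapolation φ β) :
    IsDiffQuot φ β.bar x (diffQuot φ β x) := x.2.choose_spec

/-- The constant functions, as a subspace of `preExtrapolation φ β`. -/
def constants (φ : SchurFunction U Y) (β : CPlus) : Submodule ℂ (preExtrapolation φ β) where
  carrier := {x | ∃ v : U, ∀ μ : CPlus, (x : CPlus → U) μ = v}
  zero_mem' := ⟨0, fun μ => rfl⟩
  add_mem' := by
    rintro x x' ⟨v, hv⟩ ⟨v', hv'⟩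
    exact ⟨v + v', fun μ => by simp [hv μ, hv' μ]⟩
  smul_mem' := by
    rintro c x ⟨v, hv⟩
    exact ⟨c • v, fun μ => by simp [hv μ]⟩

theorem ker_diffQuot (φ : SchurFunction U Y) (β : CPlus) :
    LinearMap.ker (diffQuot φ β) = constants φ β := by
  ext x
  rw [LinearMap.mem_ker]
  constructor
  · intro h
    refine ⟨(x : CPlus → U) β.bar, fun μ => ?_⟩
    have h1 := isDiffQuot_diffQuot φ β x μ
    rw [h, RKHS.coe_zero, Pi.zero_apply, smul_zero] at h1
    exact sub_eq_zero.mp h1.symm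
  · rintro ⟨v, hv⟩
    refine IsDiffQuot.unique (isDiffQuot_diffQuot φ β x) fun μ => ?_
    simp [hv]

/-- The concrete extrapolation space `H^d_{c,-1}`: functions whose difference quotient at `conj β`
lies in `H_c`, modulo constant functions. -/
def HdcNeg (φ : SchurFunction U Y) (β : CPlus) : Type _ :=
  preExtrapolation φ β ⧸ constants φ β

noncomputable instance (φ : SchurFunction U Y) (β : CPlus) : AddCommGroup (HdcNeg φ β) :=
  inferInstanceAs (AddCommGroup (preExtrapolation φ β ⧸ constants φ β))

noncomputable instance (φ : SchurFunction U Y) (β : CPlus) : Module ℂ (HdcNeg φ β) :=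
  inferInstanceAs (Module ℂ (preExtrapolation φ β ⧸ constants φ β))

/-- The class `[x]` of a function `x`. -/
def HdcNeg.mk (φ : SchurFunction U Y) (β : CPlus) : preExtrapolation φ β →ₗ[ℂ] HdcNeg φ β :=
  (constants φ β).mkQ

/-- The difference quotient at `conj β` of a class. -/
noncomputable def HdcNeg.diffQuot (φ : SchurFunction U Y) (β : CPlus) : HdcNeg φ β →ₗ[ℂ] Hc φ :=
  (constants φ β).liftQ (DeBranges.diffQuot φ β) (ker_diffQuot φ β).ge

theorem HdcNeg.diffQuot_injective (φ : SchurFunction U Y) (β : CPlus) :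
    Function.Injective (HdcNeg.diffQuot φ β) := by
  rw [← LinearMap.ker_eq_bot]
  exact Submodule.ker_liftQ_eq_bot _ _ _ (ker_diffQuot φ β).le

/-- The norm of a class is the `H_c`-norm of its difference quotient at `conj β`. -/
noncomputable instance (φ : SchurFunction U Y) (β : CPlus) : NormedAddCommGroup (HdcNeg φ β) :=
  NormedAddCommGroup.induced (HdcNeg φ β) (Hc φ) (HdcNeg.diffQuot φ β)
    (HdcNeg.diffQuot_injective φ β)

noncomputable instance (φ : SchurFunction U Y) (β : CPlus) : NormedSpace ℂ (HdcNeg φ β) :=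
  NormedSpace.induced ℂ (HdcNeg φ β) (Hc φ) (HdcNeg.diffQuot φ β)

/-- `e = [x]`: the function `x` belongs to the concrete extrapolation space and represents the
class `e`. -/
def Represents {φ : SchurFunction U Y} {β : CPlus} (x : CPlus → U) (e : HdcNeg φ β) : Prop :=
  ∃ hx : x ∈ preExtrapolation φ β, HdcNeg.mk φ β ⟨x, hx⟩ = e

theorem HdcNeg.norm_eq {φ : SchurFunction U Y} {β : CPlus} {x : CPlus → U} {e : HdcNeg φ β}
    (hx : Represents x e) {h : Hc φ} (hh : IsDiffQuot φ β.bar x h) : ‖e‖ = ‖h‖ := by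
  obtain ⟨hx, rfl⟩ := hx
  have : h = DeBranges.diffQuot φ β ⟨x, hx⟩ := hh.unique (isDiffQuot_diffQuot φ β ⟨x, hx⟩)
  rw [this]
  rfl

/-- Two functions represent the same class iff they differ by a constant. -/
theorem HdcNeg.mk_eq_mk_iff {φ : SchurFunction U Y} {β : CPlus} (x ξ : preExtrapolation φ β) :
    HdcNeg.mk φ β x = HdcNeg.mk φ β ξ ↔
      ∃ v : U, ∀ μ : CPlus, (x : CPlus → U) μ - (ξ : CPlus → U) μ = v :=
  Submodule.Quotient.eq (constants φ β)

end Model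

/-! ### System nodes -/

section Node

variable {X U Y : Type*} [NormedAddCommGroup X] [InnerProductSpace ℂ X]
  [NormedAddCommGroup U] [InnerProductSpace ℂ U] [NormedAddCommGroup Y] [InnerProductSpace ℂ Y]

/-- The inclusion `x ↦ (x, 0)` of the state space into the orthogonal direct sum. -/
noncomputable def inState (X U : Type*) [NormedAddCommGroup X] [InnerProductSpace ℂ X]
    [NormedAddCommGroup U] [InnerProductSpace ℂ U] : X →ₗ[ℂ] WithLp 2 (X × U) :=
  (WithLp.linearEquiv 2 ℂ (X × U)).symm.toLinearMap ∘ₗ LinearMap.inl ℂ X U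

/-- The first component `A&B` of an operator from `X × U` to `X × Y`. -/
noncomputable def nodeAB (S : WithLp 2 (X × U) →ₗ.[ℂ] WithLp 2 (X × Y)) :
    WithLp 2 (X × U) →ₗ.[ℂ] X where
  domain := S.domain
  toFun := LinearMap.fst ℂ X Y ∘ₗ (WithLp.linearEquiv 2 ℂ (X × Y)).toLinearMap ∘ₗ S.toFun

/-- The second component `C&D` of an operator from `X × U` to `X × Y`. -/
noncomputable def nodeCD (S : WithLp 2 (X × U) →ₗ.[ℂ] WithLp 2 (X × Y)) :
    WithLp 2 (X × U) →ₗ.[ℂ] Y where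
  domain := S.domain
  toFun := LinearMap.snd ℂ X Y ∘ₗ (WithLp.linearEquiv 2 ℂ (X × Y)).toLinearMap ∘ₗ S.toFun

/-- The main operator `A x = A&B (x, 0)`, with domain `{x | (x, 0) ∈ dom S}`. -/
noncomputable def mainOp (S : WithLp 2 (X × U) →ₗ.[ℂ] WithLp 2 (X × Y)) : X →ₗ.[ℂ] X where
  domain := S.domain.comap (inState X U)
  toFun := (nodeAB S).toFun ∘ₗ
    ((inState X U).domRestrict (S.domain.comap (inState X U))).codRestrict S.domain fun x => x.2

/-- The observation operator `C x = C&D (x, 0)`, with the domain of the main operator. -/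
noncomputable def obsOp (S : WithLp 2 (X × U) →ₗ.[ℂ] WithLp 2 (X × Y)) : X →ₗ.[ℂ] Y where
  domain := S.domain.comap (inState X U)
  toFun := (nodeCD S).toFun ∘ₗ
    ((inState X U).domRestrict (S.domain.comap (inState X U))).codRestrict S.domain fun x => x.2

end Node

section ModelNode

variable {U Y : Type*} [NormedAddCommGroup U] [InnerProductSpace ℂ U] [CompleteSpace U]
  [NormedAddCommGroup Y] [InnerProductSpace ℂ Y] [CompleteSpace Y]

/-- The closure of the linear span of the pairs
`((e_c(conj l)^* u, u), (l e_c(conj l)^* u, φ(l) u))`. -/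
noncomputable def nodeGraph (φ : SchurFunction U Y) :
    Submodule ℂ (WithLp 2 (Hc φ × U) × WithLp 2 (Hc φ × Y)) :=
  (Submodule.span ℂ {p | ∃ (l : CPlus) (u : U),
    p = (WithLp.toLp 2 (kerC φ l.bar u, u),
      WithLp.toLp 2 ((l : ℂ) • kerC φ l.bar u, φ.toFun l u))}).topologicalClosure

/-- The form whose vanishing expresses that an operator is scattering isometric. -/
noncomputable def scatteringForm (φ : SchurFunction U Y)
    (p : WithLp 2 (Hc φ × U) × WithLp 2 (Hc φ × Y)) :
    WithLp 2 (Hc φ × U) × WithLp 2 (Hc φ × Y) → ℂ := fun q =>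
  ⟪p.2.fst, q.1.fst⟫_ℂ + ⟪p.1.fst, q.2.fst⟫_ℂ - ⟪p.1.snd, q.1.snd⟫_ℂ + ⟪p.2.snd, q.2.snd⟫_ℂ

theorem scatteringForm_eq_zero_of (φ : SchurFunction U Y)
    (p : WithLp 2 (Hc φ × U) × WithLp 2 (Hc φ × Y))
    (hp : ∀ (l : CPlus) (u : U), scatteringForm φ p (WithLp.toLp 2 (kerC φ l.bar u, u),
      WithLp.toLp 2 ((l : ℂ) • kerC φ l.bar u, φ.toFun l u)) = 0)
    {q : WithLp 2 (Hc φ × U) × WithLp 2 (Hc φ × Y)} (hq : q ∈ nodeGraph φ) :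
    scatteringForm φ p q = 0 := by
  have hcont : Continuous (scatteringForm φ p) := by
    unfold scatteringForm
    fun_prop
  let N : Submodule ℂ (WithLp 2 (Hc φ × U) × WithLp 2 (Hc φ × Y)) :=
    { carrier := {q | scatteringForm φ p q = 0}
      zero_mem' := by simp [scatteringForm]
      add_mem' := by
        intro a b ha hb
        have ha' : scatteringForm φ p a = 0 := ha
        have hb' : scatteringForm φ p b = 0 := hb
        have : scatteringForm φ p (a + b) = scatteringForm φ p a + scatteringForm φ p b := by
          simp only [scatteringForm, Prod.fst_add, Prod.snd_add, WithLp.add_fst, WithLp.add_snd,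
            inner_add_right]
          ring
        show scatteringForm φ p (a + b) = 0
        rw [this, ha', hb', add_zero]
      smul_mem' := by
        intro c a ha
        have ha' : scatteringForm φ p a = 0 := ha
        have : scatteringForm φ p (c • a) = c * scatteringForm φ p a := by
          simp only [scatteringForm, Prod.smul_fst, Prod.smul_snd, WithLp.smul_fst,
            WithLp.smul_snd, inner_smul_right]
          ring
        show scatteringForm φ p (c • a) = 0
        rw [this, ha', mul_zero] }
  have hle : nodeGraph φ ≤ N := by
    refine Submodule.topologicalClosure_minimal _ ?_ (isClosed_eq hcont continuous_const)
    rw [Submodule.span_le]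
    rintro _ ⟨l, u, rfl⟩
    exact hp l u
  exact hle hq

theorem scatteringForm_conj (φ : SchurFunction U Y)
    (p q : WithLp 2 (Hc φ × U) × WithLp 2 (Hc φ × Y)) :
    scatteringForm φ p q = conj (scatteringForm φ q p) := by
  simp only [scatteringForm, map_add, map_sub, inner_conj_symm]
  ring

theorem scatteringForm_eq_zero (φ : SchurFunction U Y)
    {p q : WithLp 2 (Hc φ × U) × WithLp 2 (Hc φ × Y)} (hp : p ∈ nodeGraph φ)
    (hq : q ∈ nodeGraph φ) : scatteringForm φ p q = 0 := by
  refine scatteringForm_eq_zero_of φ p (fun l u => ?_) hq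
  rw [scatteringForm_conj, map_eq_zero]
  refine scatteringForm_eq_zero_of φ _ (fun m v => ?_) hp
  have hin : ∀ (l m : CPlus) (u v : U), ⟪kerC φ l u, kerC φ m v⟫_ℂ = (conj (m : ℂ) + l)⁻¹ *
      (⟪u, v⟫_ℂ - ⟪φ.toFun l.bar u, φ.toFun m.bar v⟫_ℂ) := by
    intro l m u v
    rw [kerC, kerC, ← RKHS.kernel_inner, kernel_Hc, inner_kernelC]
  have hne : (m : ℂ) + conj (l : ℂ) ≠ 0 := CPlus.add_conj_ne_zero m l
  simp only [scatteringForm, WithLp.toLp_fst, WithLp.toLp_snd, inner_smul_left, inner_smul_right,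
    hin, CPlus.bar_bar, CPlus.coe_bar, Complex.conj_conj]
  field_simp
  ring

/-- `nodeGraph φ` is the graph of a (single-valued) operator. -/
theorem nodeGraph_functional (φ : SchurFunction U Y)
    (p : WithLp 2 (Hc φ × U) × WithLp 2 (Hc φ × Y)) (hp : p ∈ nodeGraph φ) (h0 : p.1 = 0) :
    p.2 = 0 := by
  have h1 := scatteringForm_eq_zero φ hp hp
  simp only [scatteringForm, h0, WithLp.zero_fst, WithLp.zero_snd, inner_zero_right,
    inner_zero_left, zero_add, sub_zero, inner_self_eq_zero] at h1
  have h2 : p.2.fst = 0 := by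
    ext μ
    rw [RKHS.coe_zero, Pi.zero_apply]
    refine ext_inner_right ℂ fun u => ?_
    have hg : (WithLp.toLp 2 (kerC φ μ u, u), WithLp.toLp 2 ((μ.bar : ℂ) • kerC φ μ u,
        φ.toFun μ.bar u)) ∈ nodeGraph φ := by
      refine Submodule.le_topologicalClosure _ (Submodule.subset_span ⟨μ.bar, u, ?_⟩)
      rw [CPlus.bar_bar]
    have h3 := scatteringForm_eq_zero φ hp hg
    simp only [scatteringForm, h0, h1, WithLp.zero_fst, WithLp.zero_snd, inner_zero_left,
      add_zero, sub_zero, WithLp.toLp_fst] at h3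
    rw [kerC, RKHS.inner_kerFun] at h3
    rw [h3, inner_zero_left]
  exact WithLp.ofLp_injective 2 (Prod.ext h2 h1)

/-- The controllable energy-preserving model `[A&B; C&D]_c`: the closure of the linear operator
determined by `(e_c(conj l)^* u, u) ↦ (l e_c(conj l)^* u, φ(l) u)`. -/
noncomputable def nodeC (φ : SchurFunction U Y) :
    WithLp 2 (Hc φ × U) →ₗ.[ℂ] WithLp 2 (Hc φ × Y) :=
  (nodeGraph φ).toLinearPMap

theorem nodeC_graph (φ : SchurFunction U Y) : (nodeC φ).graph = nodeGraph φ :=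
  Submodule.toLinearPMap_graph_eq _ fun p hp h0 => nodeGraph_functional φ p hp h0

/-- The main operator `A_c` of the model. -/
noncomputable def opA (φ : SchurFunction U Y) : Hc φ →ₗ.[ℂ] Hc φ := mainOp (nodeC φ)

/-- The observation operator `C_c` of the model, defined on the domain of `A_c`. -/
noncomputable def opC (φ : SchurFunction U Y) : Hc φ →ₗ.[ℂ] Y := obsOp (nodeC φ)

end ModelNode

/-! ### Resolvents, control operators, adjoints with respect to the pivot space -/

section Abstract

variable {X U Y E : Type*} [NormedAddCommGroup X] [InnerProductSpace ℂ X]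
  [NormedAddCommGroup U] [InnerProductSpace ℂ U] [NormedAddCommGroup Y] [InnerProductSpace ℂ Y]
  [NormedAddCommGroup E] [NormedSpace ℂ E]

/-- `z` lies in the resolvent set of the unbounded operator `T`, and `R = (z - T)⁻¹`. -/
structure IsResolventAt (T : X →ₗ.[ℂ] X) (z : ℂ) (R : X →L[ℂ] X) : Prop where
  right_inv : ∀ x : X, ∃ hx : R x ∈ T.domain, z • R x - T ⟨R x, hx⟩ = x
  left_inv : ∀ x : T.domain, R (z • (x : X) - T x) = x

/-- `B : U → E` is the control operator of the operator `S : X × U ⊇ dom S → X × Y`, where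
`ι : X → E` is the embedding into the extrapolation space of the main operator of `S` and
`Aext : X → E` is the continuous extension of the main operator: `A&B` is the restriction of
`[Aext B]` to `dom S = {(x, u) | Aext x + B u ∈ X}`. -/
structure IsControlOp (S : WithLp 2 (X × U) →ₗ.[ℂ] WithLp 2 (X × Y)) (ι Aext : X →L[ℂ] E)
    (B : U →L[ℂ] E) : Prop where
  extend : ∀ p : S.domain, ι (S p).fst = Aext (p : WithLp 2 (X × U)).fst + B
    (p : WithLp 2 (X × U)).snd
  domain : ∀ (x : X) (u : U), WithLp.toLp 2 (x, u) ∈ S.domain ↔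
    Aext x + B u ∈ Set.range ι

/-- `B : Y → E` is the adjoint of the operator `C : X ⊇ dom C → Y`, with `X` as pivot space: the
pairing of `B y` with `x ∈ dom C`, that is, the limit of `⟪z n, x⟫` for any sequence `z` in the
dense subspace `X` of `E` with `z n → B y` in `E`, equals `⟪y, C x⟫`. -/
def IsPivotAdjoint (C : X →ₗ.[ℂ] Y) (ι : X →L[ℂ] E) (B : Y →L[ℂ] E) : Prop :=
  ∀ (y : Y) (x : C.domain) (z : ℕ → X), Tendsto (fun n => ι (z n)) atTop (𝓝 (B y)) →
    Tendsto (fun n => ⟪z n, (x : X)⟫_ℂ) atTop (𝓝 ⟪y, C x⟫_ℂ)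

end Abstract

/-- The decay condition `x(η) → 0` as `re η → ∞`. -/
def DecaysAtInfinity {U : Type*} [NormedAddCommGroup U] (x : CPlus → U) : Prop :=
  Tendsto x (comap (fun η : CPlus => (η : ℂ).re) atTop) (𝓝 0)

end DeBranges

/-!
By the reproducing property, the adjoint of the node is read off on the generators of its graph:
`S_c^* (x, y) = (z, w)` iff `μ x(μ) + φ̃(μ) y = z(μ) + w` for all `μ`
(`mem_graph_adjoint_nodeC_iff`), and similarly `A_c^* x = z` iff `μ x(μ) - z(μ)` is constant
(`mem_graph_adjoint_opA_iff`). The bound `‖K_c(μ, μ)‖ ≤ 1 / re μ` makes every element of `H_c` decay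
at infinity, so `H_c` contains no nonzero constants; this gives the density of the domains, the
injectivity of `z ↦ [z]` and the uniqueness of the decaying representative.

The analytic content is that difference quotients preserve `H_c`. The node is scattering
energy preserving, so `2 re ⟪A_c x, x⟫ + ‖C_c x‖² = 0`. Hence `l - A_c`, viewed as a map on the part
of the graph of the node with input zero, is bounded below for `re l > 0`. Its range contains
`e_c(conj m)^* u` for all `m ≠ l`, so it is dense, and `l - A_c` is onto (`range_subMainOp`). On
kernel functions, `(l - A_c)⁻¹` and `C_c (l - A_c)⁻¹` are explicit; their adjoints therefore send `z`
and `y` to the difference quotients of `z` and of `φ̃ y` at `conj l` (`isDiffQuot_dqH`,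
`isDiffQuot_dqTilde`).

The difference quotient at `conj β` is a unitary map `W` from `H^d_{c,-1}` onto `H_c` (`dqEquiv`).
In these terms `ι = W⁻¹ (conj β - A_c^*)⁻¹`, the extension of `A_c^*` is `conj β ι - W⁻¹`, and the
control operator is `W⁻¹ (C_c (β - A_c)⁻¹)^*`. All the assertions then follow by comparing
representatives up to constants.
-/

namespace DeBranges

variable {U Y : Type*} [NormedAddCommGroup U] [InnerProductSpace ℂ U] [CompleteSpace U]
  [NormedAddCommGroup Y] [InnerProductSpace ℂ Y] [CompleteSpace Y]

/-! ### Decay at infinity -/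

theorem norm_kernelC_self_le (φ : SchurFunction U Y) (μ : CPlus) :
    ‖kernelC φ μ μ‖ ≤ ((μ : ℂ).re)⁻¹ := by
  have h1 : ‖φ.toFun μ.bar‖ ≤ 1 := φ.norm_le_one _ μ.bar.2
  have h2 : ‖ContinuousLinearMap.id ℂ U - (φ.toFun μ.bar).adjoint ∘L φ.toFun μ.bar‖ ≤ 2 := by
    refine (norm_sub_le _ _).trans ?_
    have h3 : ‖(φ.toFun μ.bar).adjoint ∘L φ.toFun μ.bar‖ ≤ 1 := by
      refine (ContinuousLinearMap.opNorm_comp_le _ _).trans ?_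
      rw [LinearIsometryEquiv.norm_map]
      exact mul_le_one₀ h1 (norm_nonneg _) h1
    have h4 : ‖ContinuousLinearMap.id ℂ U‖ ≤ 1 := ContinuousLinearMap.norm_id_le
    linarith
  have h5 : (μ : ℂ) + conj (μ : ℂ) = ((2 * (μ : ℂ).re : ℝ) : ℂ) := Complex.add_conj _
  have hμ : 0 < (μ : ℂ).re := μ.2
  rw [kernelC, Matrix.of_apply, norm_smul, norm_inv, h5, Complex.norm_real,
    Real.norm_of_nonneg (by positivity)]
  calc (2 * (μ : ℂ).re)⁻¹ * _ ≤ (2 * (μ : ℂ).re)⁻¹ * 2 := by gcongr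
    _ = _ := by field_simp

theorem decaysAtInfinity_coe {φ : SchurFunction U Y} (z : Hc φ) :
    DecaysAtInfinity fun μ => z μ := by
  have h1 : Tendsto (fun t : ℝ => ‖z‖ * √(t⁻¹)) atTop (𝓝 0) := by
    have h2 := ((Real.continuous_sqrt.tendsto 0).comp tendsto_inv_atTop_zero).const_mul ‖z‖
    simpa [Function.comp_def] using h2
  refine squeeze_zero_norm (fun μ => ?_) (h1.comp tendsto_comap)
  refine (RKHS.norm_apply_le z μ).trans ?_
  rw [kernel_Hc]
  exact mul_le_mul_of_nonneg_left (Real.sqrt_le_sqrt (norm_kernelC_self_le φ μ)) (norm_nonneg _)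

instance neBot_comap_re_atTop :
    (comap (fun η : CPlus => (η : ℂ).re) atTop).NeBot := by
  refine NeBot.comap_of_range_mem inferInstance ?_
  filter_upwards [eventually_gt_atTop (0 : ℝ)] with t ht
  exact ⟨⟨(t : ℂ), by simpa using ht⟩, by simp⟩

theorem DecaysAtInfinity.eq_zero_of_forall_sub_eq {V : Type*} [NormedAddCommGroup V] {x z : CPlus → V}
    (hx : DecaysAtInfinity x) (hz : DecaysAtInfinity z) {v : V} (h : ∀ μ, x μ - z μ = v) : v = 0 := by
  have h1 := Tendsto.sub hx hz
  simp only [h, sub_zero] at h1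
  exact tendsto_nhds_unique tendsto_const_nhds h1

/-- `H_c` contains no nonzero constant functions. -/
theorem Hc_eq_zero_of_const {φ : SchurFunction U Y} {z : Hc φ} {v : U} (h : ∀ μ, z μ = v) :
    z = 0 := by
  have hv : v = 0 := DecaysAtInfinity.eq_zero_of_forall_sub_eq (decaysAtInfinity_coe z)
    (decaysAtInfinity_coe (0 : Hc φ)) (v := v) (by simpa using h)
  ext μ
  rw [h, hv, RKHS.coe_zero, Pi.zero_apply]

/-! ### The dual system node and the adjoint of the main operator -/

theorem generator_mem_nodeGraph (φ : SchurFunction U Y) (m : CPlus) (u : U) :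
    ((WithLp.toLp 2 (kerC φ m u, u), WithLp.toLp 2 ((m.bar : ℂ) • kerC φ m u, φ.toFun m.bar u)) :
      WithLp 2 (Hc φ × U) × WithLp 2 (Hc φ × Y)) ∈ nodeGraph φ := by
  refine Submodule.le_topologicalClosure _ (Submodule.subset_span ⟨m.bar, u, ?_⟩)
  rw [CPlus.bar_bar]

theorem kerC_inner (φ : SchurFunction U Y) (m : CPlus) (u : U) (f : Hc φ) :
    ⟪kerC φ m u, f⟫_ℂ = ⟪u, f m⟫_ℂ := RKHS.kerFun_inner m u f

theorem inner_kerC (φ : SchurFunction U Y) (m : CPlus) (u : U) (f : Hc φ) :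
    ⟪f, kerC φ m u⟫_ℂ = ⟪f m, u⟫_ℂ := RKHS.inner_kerFun m u f

theorem SchurFunction.tilde_inner (φ : SchurFunction U Y) (m : CPlus) (y : Y) (u : U) :
    ⟪φ.tilde m y, u⟫_ℂ = ⟪y, φ.toFun m.bar u⟫_ℂ :=
  ContinuousLinearMap.adjoint_inner_left _ _ _

/-- Pairing against the closed graph of the node can be tested on its generators, where the
reproducing property turns it into a pointwise identity. -/
theorem inner_nodeGraph_iff (φ : SchurFunction U Y) (x z : Hc φ) (y : Y) (w : U) :
    (∀ q ∈ nodeGraph φ, ⟪x, q.2.fst⟫_ℂ + ⟪y, q.2.snd⟫_ℂ = ⟪z, q.1.fst⟫_ℂ + ⟪w, q.1.snd⟫_ℂ) ↔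
      ∀ μ : CPlus, (μ : ℂ) • x μ + φ.tilde μ y = z μ + w := by
  have key : ∀ (m : CPlus) (u : U),
      ⟪x, (m.bar : ℂ) • kerC φ m u⟫_ℂ + ⟪y, φ.toFun m.bar u⟫_ℂ
          = ⟪z, kerC φ m u⟫_ℂ + ⟪w, u⟫_ℂ ↔
        ⟪(m : ℂ) • x m + φ.tilde m y, u⟫_ℂ = ⟪z m + w, u⟫_ℂ := by
    intro m u
    rw [inner_smul_right, inner_kerC, inner_kerC, inner_add_left, inner_add_left, inner_smul_left,
      SchurFunction.tilde_inner, CPlus.coe_bar]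
  constructor
  · intro h m
    refine ext_inner_right ℂ fun u => (key m u).1 ?_
    have h1 := h _ (generator_mem_nodeGraph φ m u)
    simpa only [WithLp.toLp_fst, WithLp.toLp_snd] using h1
  · intro h
    let F : WithLp 2 (Hc φ × U) × WithLp 2 (Hc φ × Y) →L[ℂ] ℂ :=
      (innerSL ℂ x ∘L WithLp.fstL 2 ℂ (Hc φ) Y + innerSL ℂ y ∘L WithLp.sndL 2 ℂ (Hc φ) Y) ∘L
          ContinuousLinearMap.snd ℂ (WithLp 2 (Hc φ × U)) (WithLp 2 (Hc φ × Y))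
        - (innerSL ℂ z ∘L WithLp.fstL 2 ℂ (Hc φ) U + innerSL ℂ w ∘L WithLp.sndL 2 ℂ (Hc φ) U) ∘L
          ContinuousLinearMap.fst ℂ (WithLp 2 (Hc φ × U)) (WithLp 2 (Hc φ × Y))
    have hF : ∀ q, F q = ⟪x, q.2.fst⟫_ℂ + ⟪y, q.2.snd⟫_ℂ - (⟪z, q.1.fst⟫_ℂ + ⟪w, q.1.snd⟫_ℂ) := by
      intro q
      rfl
    have hle : nodeGraph φ ≤ LinearMap.ker F.toLinearMap := by
      refine Submodule.topologicalClosure_minimal _ ?_ F.isClosed_ker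
      rw [Submodule.span_le]
      rintro _ ⟨l, u, rfl⟩
      have h1 := (key l.bar u).2 (by rw [h])
      rw [CPlus.bar_bar] at h1
      change F _ = 0
      rw [hF]
      simpa only [WithLp.toLp_fst, WithLp.toLp_snd, sub_eq_zero] using h1
    intro q hq
    have h2 : F q = 0 := hle hq
    rw [hF] at h2
    exact sub_eq_zero.1 h2

theorem dense_of_forall_inner_eq_zero {E : Type*} [NormedAddCommGroup E] [InnerProductSpace ℂ E]
    [CompleteSpace E] {K : Submodule ℂ E} (h : ∀ v : E, (∀ x ∈ K, ⟪x, v⟫_ℂ = 0) → v = 0) :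
    Dense (K : Set E) := by
  rw [Submodule.dense_iff_topologicalClosure_eq_top, Submodule.topologicalClosure_eq_top_iff,
    Submodule.eq_bot_iff]
  exact fun v hv => h v ((Submodule.mem_orthogonal _ _).1 hv)

theorem dense_domain_nodeC (φ : SchurFunction U Y) :
    Dense ((nodeC φ).domain : Set (WithLp 2 (Hc φ × U))) := by
  refine dense_of_forall_inner_eq_zero fun v hv => ?_
  have h1 : ∀ m : CPlus, v.fst m = -v.snd := by
    intro m
    refine ext_inner_left ℂ fun u => ?_
    have h2 := hv (WithLp.toLp 2 (kerC φ m u, u)) (LinearPMap.mem_domain_iff.2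
      ⟨_, by rw [nodeC_graph]; exact generator_mem_nodeGraph φ m u⟩)
    rw [WithLp.prod_inner_apply] at h2
    simp only at h2
    rw [show v.ofLp.1 = v.fst from rfl, show v.ofLp.2 = v.snd from rfl, kerC_inner] at h2
    rw [inner_neg_right]
    exact eq_neg_of_add_eq_zero_left h2
  have h3 : v.fst = 0 := Hc_eq_zero_of_const h1
  have h4 : v.snd = 0 := by
    have h5 := h1 ⟨1, by simp⟩
    rw [h3] at h5
    simpa using h5.symm
  exact WithLp.ofLp_injective 2 (Prod.ext h3 h4)

/-- The graph of the dual system node: `S_c^* (x, y) = (z, w)` iff `μ x(μ) + φ̃(μ) y = z(μ) + w`. -/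
theorem mem_graph_adjoint_nodeC_iff (φ : SchurFunction U Y) (x z : Hc φ) (y : Y) (w : U) :
    (WithLp.toLp 2 (x, y), WithLp.toLp 2 (z, w)) ∈ (nodeC φ).adjoint.graph ↔
      ∀ μ : CPlus, (μ : ℂ) • x μ + φ.tilde μ y = z μ + w := by
  rw [LinearPMap.adjoint_graph_eq_graph_adjoint (dense_domain_nodeC φ), Submodule.mem_adjoint_iff,
    nodeC_graph, ← inner_nodeGraph_iff]
  simp only [Prod.forall]
  refine forall_congr' fun a => forall_congr' fun b => forall_congr' fun _ => ?_
  rw [sub_eq_zero, WithLp.prod_inner_apply, WithLp.prod_inner_apply,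
    ← (starRingEnd ℂ).injective.eq_iff]
  simp only [map_add, inner_conj_symm]
  rfl

theorem mem_domain_opA_iff (φ : SchurFunction U Y) (x : Hc φ) :
    x ∈ (opA φ).domain ↔ WithLp.toLp 2 (x, (0 : U)) ∈ (nodeC φ).domain := Iff.rfl

theorem opA_opC_mem_nodeGraph (φ : SchurFunction U Y) {x : Hc φ} (hA : x ∈ (opA φ).domain)
    (hC : x ∈ (opC φ).domain) : (WithLp.toLp 2 (x, (0 : U)),
      WithLp.toLp 2 (opA φ ⟨x, hA⟩, opC φ ⟨x, hC⟩)) ∈ nodeGraph φ := by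
  rw [← nodeC_graph]
  exact (nodeC φ).mem_graph ⟨_, hA⟩

theorem mem_domain_opA_of_mem (φ : SchurFunction U Y) {x : Hc φ} {q : WithLp 2 (Hc φ × Y)}
    (h : (WithLp.toLp 2 (x, (0 : U)), q) ∈ nodeGraph φ) : x ∈ (opA φ).domain := by
  rw [mem_domain_opA_iff, LinearPMap.mem_domain_iff, nodeC_graph]
  exact ⟨q, h⟩

theorem opA_apply_of_mem (φ : SchurFunction U Y) {x : Hc φ} {q : WithLp 2 (Hc φ × Y)}
    (h : (WithLp.toLp 2 (x, (0 : U)), q) ∈ nodeGraph φ) (hx : x ∈ (opA φ).domain) :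
    opA φ ⟨x, hx⟩ = q.fst := by
  have h1 := nodeGraph_functional φ _ (sub_mem (opA_opC_mem_nodeGraph φ hx hx) h) (sub_self _)
  exact congrArg WithLp.fst (sub_eq_zero.1 h1)

/-- Differences of generators of the graph of the node have input zero. -/
theorem kerC_sub_mem_nodeGraph (φ : SchurFunction U Y) (l m : CPlus) (u : U) :
    ((WithLp.toLp 2 (kerC φ l u - kerC φ m u, 0),
      WithLp.toLp 2 ((l.bar : ℂ) • kerC φ l u - (m.bar : ℂ) • kerC φ m u,
        φ.toFun l.bar u - φ.toFun m.bar u)) :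
      WithLp 2 (Hc φ × U) × WithLp 2 (Hc φ × Y)) ∈ nodeGraph φ := by
  have h := sub_mem (generator_mem_nodeGraph φ l u) (generator_mem_nodeGraph φ m u)
  rw [Prod.mk_sub_mk, ← WithLp.toLp_sub, ← WithLp.toLp_sub, Prod.mk_sub_mk, Prod.mk_sub_mk,
    sub_self] at h
  exact h

theorem dense_domain_opA (φ : SchurFunction U Y) : Dense ((opA φ).domain : Set (Hc φ)) := by
  refine dense_of_forall_inner_eq_zero fun v hv => ?_
  refine Hc_eq_zero_of_const (v := v ⟨1, by simp⟩) fun m => ext_inner_left ℂ fun u => ?_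
  have h := hv _ (mem_domain_opA_of_mem φ (kerC_sub_mem_nodeGraph φ m ⟨1, by simp⟩ u))
  rw [inner_sub_left, kerC_inner, kerC_inner] at h
  exact sub_eq_zero.1 h

/-- The graph of `A_c^*`: `A_c^* x = z` iff `μ x(μ) - z(μ)` is constant. -/
theorem mem_graph_adjoint_opA_iff (φ : SchurFunction U Y) (x z : Hc φ) :
    (x, z) ∈ (opA φ).adjoint.graph ↔ ∃ w : U, ∀ μ : CPlus, (μ : ℂ) • x μ = z μ + w := by
  rw [LinearPMap.adjoint_graph_eq_graph_adjoint (dense_domain_opA φ), Submodule.mem_adjoint_iff]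
  constructor
  · intro h
    let o : CPlus := ⟨1, by simp⟩
    refine ⟨(o : ℂ) • x o - z o, fun m => ?_⟩
    suffices hs : (m : ℂ) • x m - (o : ℂ) • x o = z m - z o by
      rw [sub_eq_iff_eq_add] at hs
      rw [hs]
      abel
    refine ext_inner_left ℂ fun u => ?_
    have hm := kerC_sub_mem_nodeGraph φ m o u
    have hd := mem_domain_opA_of_mem φ hm
    have h1 := h _ _ (by simpa only using (opA φ).mem_graph ⟨_, hd⟩)
    rw [opA_apply_of_mem φ hm hd, WithLp.toLp_fst, inner_sub_left, inner_sub_left, inner_smul_left,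
      inner_smul_left, kerC_inner, kerC_inner, kerC_inner, kerC_inner, CPlus.coe_bar,
      CPlus.coe_bar, Complex.conj_conj, Complex.conj_conj] at h1
    rw [inner_sub_right, inner_sub_right, inner_smul_right, inner_smul_right]
    exact sub_eq_zero.1 h1
  · rintro ⟨w, hw⟩ a b hab
    obtain ⟨⟨a', ha⟩, h1, rfl⟩ := (LinearPMap.mem_graph_iff _).1 hab
    obtain rfl : a' = a := h1
    have h2 := (inner_nodeGraph_iff φ x z 0 w).2 (fun μ => by rw [map_zero, add_zero, hw])
      _ (opA_opC_mem_nodeGraph φ ha ha)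
    simp only [WithLp.toLp_fst, WithLp.toLp_snd, inner_zero_left, inner_zero_right,
      add_zero] at h2
    rw [sub_eq_zero, ← (starRingEnd ℂ).injective.eq_iff, inner_conj_symm, inner_conj_symm]
    exact h2

theorem mem_domain_adjoint_opA_iff (φ : SchurFunction U Y) (x : Hc φ) :
    x ∈ (opA φ).adjoint.domain ↔ ∃ (z : Hc φ) (w : U), ∀ μ : CPlus, (μ : ℂ) • x μ = z μ + w := by
  simp only [LinearPMap.mem_domain_iff, mem_graph_adjoint_opA_iff]

theorem adjoint_opA_apply (φ : SchurFunction U Y) (x : (opA φ).adjoint.domain) :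
    ∃ w : U, ∀ μ : CPlus, (μ : ℂ) • (x : Hc φ) μ = (opA φ).adjoint x μ + w :=
  (mem_graph_adjoint_opA_iff φ _ _).1 ((opA φ).adjoint.mem_graph x)

theorem adjoint_opA_eq (φ : SchurFunction U Y) {x z : Hc φ} {w : U}
    (h : ∀ μ : CPlus, (μ : ℂ) • x μ = z μ + w) (hx : x ∈ (opA φ).adjoint.domain) :
    (opA φ).adjoint ⟨x, hx⟩ = z := by
  obtain ⟨y, h1, h2⟩ := (LinearPMap.mem_graph_iff _).1 ((mem_graph_adjoint_opA_iff φ x z).2 ⟨w, h⟩)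
  obtain rfl : y = ⟨x, hx⟩ := Subtype.ext h1
  exact h2

/-! ### The resolvent of the main operator -/

/-- The part of the graph of the node whose input is zero: the set of all
`((x, 0), (A_c x, C_c x))` with `x ∈ dom A_c`. -/
noncomputable def zeroInput (φ : SchurFunction U Y) :
    Submodule ℂ (WithLp 2 (Hc φ × U) × WithLp 2 (Hc φ × Y)) :=
  nodeGraph φ ⊓ LinearMap.ker
    (WithLp.sndL 2 ℂ (Hc φ) U ∘L ContinuousLinearMap.fst ℂ _ (WithLp 2 (Hc φ × Y))).toLinearMap

theorem zeroInput_snd {φ : SchurFunction U Y} (p : zeroInput φ) : p.1.1.snd = 0 := p.2.2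

theorem zeroInput_fst {φ : SchurFunction U Y} (p : zeroInput φ) :
    p.1.1 = WithLp.toLp 2 (p.1.1.fst, 0) :=
  WithLp.ofLp_injective 2 (Prod.ext rfl (zeroInput_snd p))

instance completeSpace_zeroInput (φ : SchurFunction U Y) : CompleteSpace (zeroInput φ) := by
  refine IsClosed.completeSpace_coe (hs := ?_)
  exact (Submodule.isClosed_topologicalClosure _).inter (ContinuousLinearMap.isClosed_ker _)

/-- The map `((x, 0), (A_c x, C_c x)) ↦ (l - A_c) x`. -/
noncomputable def subMainOp (φ : SchurFunction U Y) (l : CPlus) : zeroInput φ →L[ℂ] Hc φ :=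
  ((l : ℂ) • (WithLp.fstL 2 ℂ (Hc φ) U ∘L ContinuousLinearMap.fst ℂ _ _)
    - WithLp.fstL 2 ℂ (Hc φ) Y ∘L ContinuousLinearMap.snd ℂ _ _) ∘L (zeroInput φ).subtypeL

theorem subMainOp_apply (φ : SchurFunction U Y) (l : CPlus) (p : zeroInput φ) :
    subMainOp φ l p = (l : ℂ) • p.1.1.fst - p.1.2.fst := rfl

theorem norm_le_norm_fst_add_norm_snd {E F : Type*} [SeminormedAddCommGroup E]
    [SeminormedAddCommGroup F] (x : WithLp 2 (E × F)) : ‖x‖ ≤ ‖x.fst‖ + ‖x.snd‖ := by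
  rw [WithLp.prod_norm_eq_of_L2]
  refine Real.sqrt_le_iff.2 ⟨by positivity, ?_⟩
  nlinarith [norm_nonneg x.fst, norm_nonneg x.snd]

/-- The energy balance `2 Re ⟪A_c x, x⟫ + ‖C_c x‖² = 0`, written in terms of `t = (l - A_c) x`. -/
theorem energy_zeroInput (φ : SchurFunction U Y) (l : CPlus) (p : zeroInput φ) :
    2 * (l : ℂ).re * ‖p.1.1.fst‖ ^ 2 + ‖p.1.2.snd‖ ^ 2
      = 2 * (⟪subMainOp φ l p, p.1.1.fst⟫_ℂ).re := by
  have h := scatteringForm_eq_zero φ p.2.1 p.2.1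
  have h1 : p.1.2.fst = (l : ℂ) • p.1.1.fst - subMainOp φ l p := by
    rw [subMainOp_apply]; abel
  simp only [scatteringForm, zeroInput_snd, inner_zero_left, sub_zero] at h
  rw [h1, inner_sub_left, inner_sub_right, inner_smul_left, inner_smul_right,
    inner_self_eq_norm_sq_to_K, inner_self_eq_norm_sq_to_K,
    ← inner_conj_symm p.1.1.fst (subMainOp φ l p)] at h
  have h2 := congrArg Complex.re h
  simp only [Complex.add_re, Complex.sub_re, Complex.mul_re, Complex.conj_re, Complex.conj_im,
    Complex.zero_re, Complex.coe_algebraMap, ← Complex.ofReal_pow, Complex.ofReal_re,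
    Complex.ofReal_im] at h2
  linarith

/-- `l - A_c` is bounded below, even with respect to the graph norm that includes `C_c x`; this is
why its range is closed. -/
theorem norm_zeroInput_le (φ : SchurFunction U Y) (l : CPlus) (p : zeroInput φ) :
    ‖p‖ ≤ (2 + (2 + ‖(l : ℂ)‖) * ((l : ℂ).re)⁻¹) * ‖subMainOp φ l p‖ := by
  have hE := energy_zeroInput φ l p
  have hCS : (⟪subMainOp φ l p, p.1.1.fst⟫_ℂ).re ≤ ‖subMainOp φ l p‖ * ‖p.1.1.fst‖ :=
    re_inner_le_norm (𝕜 := ℂ) _ _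
  have h1 : p.1.2.fst = (l : ℂ) • p.1.1.fst - subMainOp φ l p := by
    rw [subMainOp_apply]; abel
  have hz : ‖p.1.2.fst‖ ≤ ‖(l : ℂ)‖ * ‖p.1.1.fst‖ + ‖subMainOp φ l p‖ := by
    rw [h1]
    refine (norm_sub_le _ _).trans ?_
    rw [norm_smul]
  have hl : 0 < (l : ℂ).re := l.2
  have hp1 := norm_le_norm_fst_add_norm_snd p.1.1
  have hp2 := norm_le_norm_fst_add_norm_snd p.1.2
  rw [zeroInput_snd, norm_zero, add_zero] at hp1
  set t := ‖subMainOp φ l p‖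
  set a := ‖p.1.1.fst‖
  set b := ‖p.1.2.snd‖
  set r := (l : ℂ).re
  have ht : 0 ≤ t := norm_nonneg _
  have ha : 0 ≤ a := norm_nonneg _
  have hb : 0 ≤ b := norm_nonneg _
  have har : a ≤ r⁻¹ * t := by
    rw [inv_mul_eq_div, le_div_iff₀ hl]
    by_contra! hc
    have : 0 < a := by
      by_contra! h0
      nlinarith
    nlinarith [sq_nonneg b]
  have hi : 0 < r⁻¹ := inv_pos.2 hl
  have hbt : b ≤ (1 + r⁻¹) * t := by
    refine abs_le_of_sq_le_sq' ?_ (by positivity) |>.2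
    have h3 : b ^ 2 ≤ 2 * t * a := by nlinarith [mul_nonneg hl.le (sq_nonneg a)]
    have h4 : 2 * t * a ≤ 2 * t * (r⁻¹ * t) := by gcongr
    nlinarith [mul_nonneg (sq_nonneg t) (sq_nonneg r⁻¹), sq_nonneg t]
  have hla : ‖(l : ℂ)‖ * a ≤ ‖(l : ℂ)‖ * (r⁻¹ * t) := by gcongr
  have hn : ‖p‖ = max ‖p.1.1‖ ‖p.1.2‖ := rfl
  have h5 : 0 ≤ ‖(l : ℂ)‖ * (r⁻¹ * t) := by positivity
  have h6 : 0 ≤ r⁻¹ * t := by positivity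
  rw [hn]
  refine max_le ?_ ?_ <;> nlinarith

theorem ker_subMainOp (φ : SchurFunction U Y) (l : CPlus) :
    LinearMap.ker (subMainOp φ l).toLinearMap = ⊥ := by
  rw [Submodule.eq_bot_iff]
  intro p hp
  have h := norm_zeroInput_le φ l p
  rw [show subMainOp φ l p = 0 from hp, norm_zero, mul_zero] at h
  exact norm_le_zero_iff.1 h

/-- The element of the zero-input graph over `e_c(conj l)^* u - e_c(conj m)^* u`. -/
noncomputable def kerSub (φ : SchurFunction U Y) (l m : CPlus) (u : U) : zeroInput φ :=
  ⟨_, kerC_sub_mem_nodeGraph φ l.bar m.bar u, rfl⟩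

theorem subMainOp_kerSub (φ : SchurFunction U Y) (l m : CPlus) (u : U) :
    subMainOp φ l (kerSub φ l m u) = ((m : ℂ) - l) • kerC φ m.bar u := by
  rw [subMainOp_apply]
  simp only [kerSub, WithLp.toLp_fst, CPlus.bar_bar]
  rw [smul_sub, sub_smul]
  abel

theorem range_subMainOp (φ : SchurFunction U Y) (l : CPlus) :
    LinearMap.range (subMainOp φ l).toLinearMap = ⊤ := by
  have hanti : AntilipschitzWith
      (Real.toNNReal (2 + (2 + ‖(l : ℂ)‖) * ((l : ℂ).re)⁻¹)) (subMainOp φ l) := by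
    refine ContinuousLinearMap.antilipschitz_of_bound _ fun p => ?_
    have : 0 < (l : ℂ).re := l.2
    rw [Real.coe_toNNReal _ (by positivity)]
    exact norm_zeroInput_le φ l p
  have hclosed : IsClosed (LinearMap.range (subMainOp φ l).toLinearMap : Set (Hc φ)) :=
    hanti.isClosed_range (subMainOp φ l).uniformContinuous
  refine SetLike.coe_injective ?_
  rw [← hclosed.closure_eq, Submodule.top_coe]
  refine Dense.closure_eq (dense_of_forall_inner_eq_zero fun v hv => ?_)
  refine Hc_eq_zero φ l.bar v fun m => ext_inner_left ℂ fun u => ?_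
  have h := hv _ ⟨kerSub φ l m.bar u, subMainOp_kerSub φ l m.bar u⟩
  rw [inner_smul_left, kerC_inner, CPlus.bar_bar, map_sub, CPlus.coe_bar, Complex.conj_conj] at h
  rw [inner_smul_right, inner_zero_right, CPlus.coe_bar, ← neg_sub, neg_mul, h, neg_zero]

/-- `(l - A_c)` as an isomorphism from the zero-input graph to `H_c`. -/
noncomputable def resolventEquiv (φ : SchurFunction U Y) (l : CPlus) : zeroInput φ ≃L[ℂ] Hc φ :=
  ContinuousLinearEquiv.ofBijective (subMainOp φ l) (ker_subMainOp φ l) (range_subMainOp φ l)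

/-- The resolvent `(l - A_c)⁻¹`. -/
noncomputable def resolventA (φ : SchurFunction U Y) (l : CPlus) : Hc φ →L[ℂ] Hc φ :=
  WithLp.fstL 2 ℂ (Hc φ) U ∘L ContinuousLinearMap.fst ℂ _ (WithLp 2 (Hc φ × Y)) ∘L
    (zeroInput φ).subtypeL ∘L (resolventEquiv φ l).symm.toContinuousLinearMap

/-- The operator `C_c (l - A_c)⁻¹`. -/
noncomputable def obsResolvent (φ : SchurFunction U Y) (l : CPlus) : Hc φ →L[ℂ] Y :=
  WithLp.sndL 2 ℂ (Hc φ) Y ∘L ContinuousLinearMap.snd ℂ (WithLp 2 (Hc φ × U)) _ ∘L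
    (zeroInput φ).subtypeL ∘L (resolventEquiv φ l).symm.toContinuousLinearMap

theorem resolventA_subMainOp (φ : SchurFunction U Y) (l : CPlus) (p : zeroInput φ) :
    resolventA φ l (subMainOp φ l p) = p.1.1.fst := by
  have h : (resolventEquiv φ l).symm (subMainOp φ l p) = p :=
    (resolventEquiv φ l).symm_apply_apply p
  simp [resolventA, h]

theorem obsResolvent_subMainOp (φ : SchurFunction U Y) (l : CPlus) (p : zeroInput φ) :
    obsResolvent φ l (subMainOp φ l p) = p.1.2.snd := by
  have h : (resolventEquiv φ l).symm (subMainOp φ l p) = p :=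
    (resolventEquiv φ l).symm_apply_apply p
  simp [obsResolvent, h]

theorem exists_subMainOp_eq (φ : SchurFunction U Y) (l : CPlus) (v : Hc φ) :
    ∃ p, subMainOp φ l p = v := ⟨_, (resolventEquiv φ l).apply_symm_apply v⟩

theorem resolventA_injective (φ : SchurFunction U Y) (l : CPlus) :
    Function.Injective (resolventA φ l) := by
  rw [injective_iff_map_eq_zero]
  intro v hv
  obtain ⟨p, rfl⟩ := exists_subMainOp_eq φ l v
  rw [resolventA_subMainOp] at hv
  have h1 : p.1.1 = 0 := by
    rw [zeroInput_fst, hv]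
    rfl
  rw [subMainOp_apply, hv, nodeGraph_functional φ _ p.2.1 h1]
  simp

/-! ### Difference quotients as bounded operators -/

/-- The difference quotient at `a` as an operator on `H_c`, the adjoint of the resolvent
`(conj a - A_c)⁻¹`. -/
noncomputable def dqH (φ : SchurFunction U Y) (a : CPlus) : Hc φ →L[ℂ] Hc φ :=
  (resolventA φ a.bar).adjoint

theorem isDiffQuot_dqH (φ : SchurFunction U Y) (a : CPlus) (z : Hc φ) :
    IsDiffQuot φ a (fun μ => z μ) (dqH φ a z) := by
  intro m
  refine ext_inner_left ℂ fun u => ?_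
  rw [inner_smul_right, ← kerC_inner, dqH, ContinuousLinearMap.adjoint_inner_right]
  have h := subMainOp_kerSub φ a.bar m.bar u
  have h1 := resolventA_subMainOp φ a.bar (kerSub φ a.bar m.bar u)
  rw [h, CPlus.bar_bar, map_smul] at h1
  have h2 := congrArg (fun w => ⟪w, z⟫_ℂ) h1
  simp only [kerSub, WithLp.toLp_fst, CPlus.bar_bar, inner_smul_left, inner_sub_left, kerC_inner,
    CPlus.coe_bar, map_sub, Complex.conj_conj] at h2
  rw [inner_sub_right]
  linear_combination -h2

/-- The map `y ↦ (φ̃(μ) y - φ̃(a) y) / (a - μ)`, the adjoint of `C_c (conj a - A_c)⁻¹`. -/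
noncomputable def dqTilde (φ : SchurFunction U Y) (a : CPlus) : Y →L[ℂ] Hc φ :=
  (obsResolvent φ a.bar).adjoint

theorem isDiffQuot_dqTilde (φ : SchurFunction U Y) (a : CPlus) (y : Y) :
    IsDiffQuot φ a (fun μ => φ.tilde μ y) (dqTilde φ a y) := by
  intro m
  refine ext_inner_right ℂ fun u => ?_
  rw [inner_smul_left, ← inner_kerC, dqTilde, ContinuousLinearMap.adjoint_inner_left]
  have h := subMainOp_kerSub φ a.bar m.bar u
  have h1 := obsResolvent_subMainOp φ a.bar (kerSub φ a.bar m.bar u)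
  rw [h, CPlus.bar_bar, map_smul] at h1
  have h2 := congrArg (fun w => ⟪y, w⟫_ℂ) h1
  simp only [kerSub, WithLp.toLp_snd, CPlus.bar_bar, inner_smul_right, inner_sub_right,
    CPlus.coe_bar] at h2
  rw [inner_sub_left, SchurFunction.tilde_inner, SchurFunction.tilde_inner, map_sub,
    CPlus.coe_bar, CPlus.coe_bar]
  linear_combination -h2

/-- The range of the difference quotient operators on `H_c` lies in `dom A_c^*`. -/
theorem IsDiffQuot.mem_domain {φ : SchurFunction U Y} {a : CPlus} {z w : Hc φ}
    (h : IsDiffQuot φ a (fun μ => z μ) w) : w ∈ (opA φ).adjoint.domain := by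
  refine (mem_domain_adjoint_opA_iff φ w).2 ⟨(a : ℂ) • w - z, z a, fun μ => ?_⟩
  have h1 := h μ
  rw [sub_smul] at h1
  rw [RKHS.coe_sub, RKHS.coe_smul, Pi.sub_apply, Pi.smul_apply, ← sub_eq_zero]
  rw [← sub_eq_zero] at h1
  rw [← neg_eq_zero, ← h1]
  abel

theorem isResolventAt_dqH (φ : SchurFunction U Y) (a : CPlus) :
    IsResolventAt (opA φ).adjoint a (dqH φ a) where
  right_inv z := by
    have h := isDiffQuot_dqH φ a z
    refine ⟨h.mem_domain, ?_⟩
    rw [adjoint_opA_eq φ (z := (a : ℂ) • dqH φ a z - z) (w := z a) fun μ => ?_]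
    · abel
    have h1 := h μ
    rw [sub_smul] at h1
    rw [RKHS.coe_sub, RKHS.coe_smul, Pi.sub_apply, Pi.smul_apply, ← sub_eq_zero]
    rw [← sub_eq_zero] at h1
    rw [← neg_eq_zero, ← h1]
    abel
  left_inv x := by
    obtain ⟨w, hw⟩ := adjoint_opA_apply φ x
    refine (isDiffQuot_dqH φ a _).unique fun μ => ?_
    have h1 := hw μ
    have h2 := hw a
    simp only [RKHS.coe_sub, RKHS.coe_smul, Pi.sub_apply, Pi.smul_apply]
    rw [sub_smul, h1, h2]
    abel

theorem denseRange_dqH (φ : SchurFunction U Y) (a : CPlus) : DenseRange (dqH φ a) := by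
  change Dense (LinearMap.range (dqH φ a).toLinearMap : Set (Hc φ))
  refine dense_of_forall_inner_eq_zero fun v hv => resolventA_injective φ a.bar ?_
  rw [map_zero]
  refine ext_inner_left ℂ fun z => ?_
  rw [inner_zero_right, ← ContinuousLinearMap.adjoint_inner_left]
  exact hv _ ⟨z, rfl⟩

theorem dense_domain_adjoint_opA (φ : SchurFunction U Y) :
    Dense ((opA φ).adjoint.domain : Set (Hc φ)) := by
  refine (denseRange_dqH φ ⟨1, by simp⟩).mono ?_
  rintro _ ⟨z, rfl⟩
  exact (isDiffQuot_dqH φ _ z).mem_domain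

/-! ### The concrete extrapolation space -/

theorem isDiffQuot_sub_smul (φ : SchurFunction U Y) (a : CPlus) (h : Hc φ) :
    IsDiffQuot φ a (fun μ => ((a : ℂ) - μ) • h μ) h := fun μ => by simp

theorem diffQuot_mk {φ : SchurFunction U Y} {β : CPlus} {x : CPlus → U}
    (hx : x ∈ preExtrapolation φ β) {h : Hc φ} (hh : IsDiffQuot φ β.bar x h) :
    HdcNeg.diffQuot φ β (HdcNeg.mk φ β ⟨x, hx⟩) = h :=
  (isDiffQuot_diffQuot φ β ⟨x, hx⟩).unique hh

/-- The unitary map from `H^d_{c,-1}` onto `H_c` sending `[x]` to the difference quotient of `x` at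
`conj β`. -/
noncomputable def dqEquiv (φ : SchurFunction U Y) (β : CPlus) : HdcNeg φ β ≃ₗᵢ[ℂ] Hc φ :=
  LinearIsometryEquiv.ofSurjective ⟨HdcNeg.diffQuot φ β, fun _ => rfl⟩ fun h =>
    ⟨HdcNeg.mk φ β ⟨_, h, isDiffQuot_sub_smul φ β.bar h⟩,
      diffQuot_mk _ (isDiffQuot_sub_smul φ β.bar h)⟩

theorem represents_iff {φ : SchurFunction U Y} {β : CPlus} {x : CPlus → U} {e : HdcNeg φ β} :
    Represents x e ↔ IsDiffQuot φ β.bar x (dqEquiv φ β e) := by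
  constructor
  · rintro ⟨hx, rfl⟩
    exact isDiffQuot_diffQuot φ β ⟨x, hx⟩
  · intro h
    exact ⟨⟨_, h⟩, (dqEquiv φ β).injective (diffQuot_mk _ h)⟩

theorem completeSpace_HdcNeg (φ : SchurFunction U Y) (β : CPlus) :
    CompleteSpace (HdcNeg φ β) :=
  (dqEquiv φ β).toIsometryEquiv.completeSpace

theorem IsDiffQuot.congr_of_sub_eq {φ : SchurFunction U Y} {a : CPlus} {x x' : CPlus → U}
    {h : Hc φ} (hh : IsDiffQuot φ a x h) {v : U} (hv : ∀ μ, x' μ = x μ + v) :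
    IsDiffQuot φ a x' h := fun μ => by
  rw [hh μ, hv, hv, add_sub_add_right_eq_sub]

theorem Represents.congr_of_sub_eq {φ : SchurFunction U Y} {β : CPlus} {x x' : CPlus → U}
    {e : HdcNeg φ β} (hx : Represents x e) {v : U} (hv : ∀ μ, x' μ = x μ + v) :
    Represents x' e :=
  represents_iff.2 ((represents_iff.1 hx).congr_of_sub_eq hv)

theorem Represents.exists_sub_eq {φ : SchurFunction U Y} {β : CPlus} {x x' : CPlus → U}
    {e : HdcNeg φ β} (hx : Represents x e) (hx' : Represents x' e) :
    ∃ v : U, ∀ μ, x' μ = x μ + v := by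
  refine ⟨x' β.bar - x β.bar, fun μ => ?_⟩
  have h1 := represents_iff.1 hx μ
  have h2 := represents_iff.1 hx' μ
  rw [h1] at h2
  rw [eq_comm, sub_eq_iff_eq_add] at h2
  rw [h2]
  abel

theorem Represents.unique {φ : SchurFunction U Y} {β : CPlus} {x : CPlus → U}
    {e e' : HdcNeg φ β} (h : Represents x e) (h' : Represents x e') : e = e' :=
  (dqEquiv φ β).injective ((represents_iff.1 h).unique (represents_iff.1 h'))

theorem Represents.exists {φ : SchurFunction U Y} {β : CPlus} (e : HdcNeg φ β) :
    ∃ x : CPlus → U, Represents x e :=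
  ⟨_, represents_iff.2 (isDiffQuot_sub_smul φ β.bar (dqEquiv φ β e))⟩

theorem Represents.add {φ : SchurFunction U Y} {β : CPlus} {x x' : CPlus → U}
    {e e' : HdcNeg φ β} (h : Represents x e) (h' : Represents x' e') :
    Represents (fun μ => x μ + x' μ) (e + e') := by
  obtain ⟨hx, rfl⟩ := h
  obtain ⟨hx', rfl⟩ := h'
  exact ⟨add_mem hx hx', map_add (HdcNeg.mk φ β) ⟨x, hx⟩ ⟨x', hx'⟩⟩

theorem Represents.smul {φ : SchurFunction U Y} {β : CPlus} {x : CPlus → U}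
    {e : HdcNeg φ β} (c : ℂ) (h : Represents x e) :
    Represents (fun μ => c • x μ) (c • e) := by
  obtain ⟨hx, rfl⟩ := h
  exact ⟨Submodule.smul_mem _ c hx, map_smul (HdcNeg.mk φ β) c ⟨x, hx⟩⟩

theorem Represents.sub {φ : SchurFunction U Y} {β : CPlus} {x x' : CPlus → U}
    {e e' : HdcNeg φ β} (h : Represents x e) (h' : Represents x' e') :
    Represents (fun μ => x μ - x' μ) (e - e') := by
  obtain ⟨hx, rfl⟩ := h
  obtain ⟨hx', rfl⟩ := h'
  exact ⟨sub_mem hx hx', map_sub (HdcNeg.mk φ β) ⟨x, hx⟩ ⟨x', hx'⟩⟩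

/-- The embedding `z ↦ [z]` of `H_c` into `H^d_{c,-1}`. -/
noncomputable def embH (φ : SchurFunction U Y) (β : CPlus) : Hc φ →L[ℂ] HdcNeg φ β :=
  (dqEquiv φ β).symm.toContinuousLinearEquiv.toContinuousLinearMap ∘L dqH φ β.bar

theorem dqEquiv_embH (φ : SchurFunction U Y) (β : CPlus) (z : Hc φ) :
    dqEquiv φ β (embH φ β z) = dqH φ β.bar z := (dqEquiv φ β).apply_symm_apply _

theorem represents_embH (φ : SchurFunction U Y) (β : CPlus) (z : Hc φ) :
    Represents (fun μ => z μ) (embH φ β z) := by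
  rw [represents_iff, dqEquiv_embH]
  exact isDiffQuot_dqH φ β.bar z

theorem norm_embH (φ : SchurFunction U Y) (β : CPlus) (z : Hc φ) :
    ‖embH φ β z‖ = ‖dqH φ β.bar z‖ := by
  rw [← dqEquiv_embH, LinearIsometryEquiv.norm_map]

theorem embH_injective (φ : SchurFunction U Y) (β : CPlus) :
    Function.Injective (embH φ β) := by
  rw [injective_iff_map_eq_zero]
  intro z hz
  have h1 := represents_embH φ β z
  rw [hz] at h1
  have h0 : Represents (fun _ => (0 : U)) (0 : HdcNeg φ β) :=
    ⟨zero_mem _, map_zero (HdcNeg.mk φ β)⟩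
  obtain ⟨v, hv⟩ := h0.exists_sub_eq h1
  exact Hc_eq_zero_of_const hv

theorem denseRange_embH (φ : SchurFunction U Y) (β : CPlus) : DenseRange (embH φ β) :=
  (dqEquiv φ β).symm.surjective.denseRange.comp (denseRange_dqH φ β.bar)
    (dqEquiv φ β).symm.continuous

/-- The operator sending `[x]` to the difference quotient of `x` at `a`, obtained from the
difference quotient `h` at `conj β` as `h + (conj β - a) dqH a h`. -/
noncomputable def dqExt (φ : SchurFunction U Y) (β a : CPlus) : HdcNeg φ β →L[ℂ] Hc φ :=
  (ContinuousLinearMap.id ℂ _ + ((β.bar : ℂ) - a) • dqH φ a) ∘L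
    (dqEquiv φ β).toContinuousLinearEquiv.toContinuousLinearMap

theorem isDiffQuot_dqExt {φ : SchurFunction U Y} {β : CPlus} (a : CPlus) {x : CPlus → U}
    {e : HdcNeg φ β} (hx : Represents x e) : IsDiffQuot φ a x (dqExt φ β a e) := by
  intro μ
  set h := dqEquiv φ β e with hh
  have e1 : dqExt φ β a e = h + ((β.bar : ℂ) - a) • dqH φ a h := rfl
  have h1 : ((β.bar : ℂ) - μ) • h μ = x μ - x β.bar := represents_iff.1 hx μ
  have h2 : ((β.bar : ℂ) - a) • h a = x a - x β.bar := represents_iff.1 hx a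
  have h3 : ((a : ℂ) - μ) • dqH φ a h μ = h μ - h a := isDiffQuot_dqH φ a h μ
  rw [e1, RKHS.coe_add, RKHS.coe_smul, Pi.add_apply, Pi.smul_apply, smul_add, smul_comm, h3,
    smul_sub, h2, ← add_sub_assoc, ← add_smul, sub_add_sub_comm, add_comm (a : ℂ),
    add_sub_add_right_eq_sub, h1]
  abel

/-- A class lies in `ι(H_c)` iff its difference quotient at a given point lies in `dom A_c^*`: if
`A_c^* w = z`, the decaying representative is `a w - z`. -/
theorem IsDiffQuot.mem_domain_iff {φ : SchurFunction U Y} {β a : CPlus} {x : CPlus → U}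
    {e : HdcNeg φ β} (hx : Represents x e) {w : Hc φ} (hw : IsDiffQuot φ a x w) :
    w ∈ (opA φ).adjoint.domain ↔ e ∈ Set.range (embH φ β) := by
  constructor
  · intro h
    obtain ⟨z, c, hz⟩ := (mem_domain_adjoint_opA_iff φ w).1 h
    refine ⟨(a : ℂ) • w - z, (represents_embH φ β _).unique
      (hx.congr_of_sub_eq (v := c - x a) fun μ => ?_)⟩
    have h1 := hw μ
    rw [sub_smul, hz] at h1
    rw [RKHS.coe_sub, RKHS.coe_smul, Pi.sub_apply, Pi.smul_apply, ← sub_eq_zero]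
    rw [← sub_eq_zero] at h1
    rw [← h1]
    abel
  · rintro ⟨z, rfl⟩
    obtain ⟨v, hv⟩ := hx.exists_sub_eq (represents_embH φ β z)
    exact (hw.congr_of_sub_eq hv).mem_domain

/-! ### The extended adjoint of the main operator and the control operator -/

/-- The extension `x ↦ [μ ↦ μ x(μ)]` of `A_c^*` to a bounded operator from `H_c` to
`H^d_{c,-1}`. -/
noncomputable def adjExt (φ : SchurFunction U Y) (β : CPlus) : Hc φ →L[ℂ] HdcNeg φ β :=
  (β.bar : ℂ) • embH φ β - (dqEquiv φ β).symm.toContinuousLinearEquiv.toContinuousLinearMap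

theorem adjExt_apply (φ : SchurFunction U Y) (β : CPlus) (x : Hc φ) :
    adjExt φ β x = (β.bar : ℂ) • embH φ β x - (dqEquiv φ β).symm x := rfl

theorem represents_adjExt (φ : SchurFunction U Y) (β : CPlus) (x : Hc φ) :
    Represents (fun μ => (μ : ℂ) • x μ) (adjExt φ β x) := by
  have h1 : Represents (fun μ : CPlus => ((β.bar : ℂ) - μ) • x μ) ((dqEquiv φ β).symm x) := by
    rw [represents_iff, LinearIsometryEquiv.apply_symm_apply]
    exact isDiffQuot_sub_smul φ β.bar x
  have h2 := ((represents_embH φ β x).smul (β.bar : ℂ)).sub h1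
  rw [adjExt_apply]
  convert h2 using 2 with μ
  rw [sub_smul, sub_sub_cancel]

theorem adjExt_eq (φ : SchurFunction U Y) (β : CPlus) (x : (opA φ).adjoint.domain) :
    adjExt φ β x = embH φ β ((opA φ).adjoint x) := by
  obtain ⟨w, hw⟩ := adjoint_opA_apply φ x
  exact (represents_adjExt φ β x).unique ((represents_embH φ β _).congr_of_sub_eq hw)

/-- The control operator `y ↦ [μ ↦ φ̃(μ) y]` of the dual system node. -/
noncomputable def ctrlOp (φ : SchurFunction U Y) (β : CPlus) : Y →L[ℂ] HdcNeg φ β :=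
  (dqEquiv φ β).symm.toContinuousLinearEquiv.toContinuousLinearMap ∘L dqTilde φ β.bar

theorem dqEquiv_ctrlOp (φ : SchurFunction U Y) (β : CPlus) (y : Y) :
    dqEquiv φ β (ctrlOp φ β y) = dqTilde φ β.bar y := (dqEquiv φ β).apply_symm_apply _

theorem represents_ctrlOp (φ : SchurFunction U Y) (β : CPlus) (y : Y) :
    Represents (fun μ => φ.tilde μ y) (ctrlOp φ β y) := by
  rw [represents_iff, dqEquiv_ctrlOp]
  exact isDiffQuot_dqTilde φ β.bar y

/-- The dual system node is the restriction of `x, y ↦ A_c^* x + C_c^* y` to the pairs mapped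
into `ι(H_c)`. -/
theorem adjExt_add_ctrlOp_eq_iff (φ : SchurFunction U Y) (β : CPlus) (x z : Hc φ) (y : Y) :
    embH φ β z = adjExt φ β x + ctrlOp φ β y ↔
      ∃ w : U, (WithLp.toLp 2 (x, y), WithLp.toLp 2 (z, w)) ∈ (nodeC φ).adjoint.graph := by
  simp only [mem_graph_adjoint_nodeC_iff]
  have h1 := (represents_adjExt φ β x).add (represents_ctrlOp φ β y)
  constructor
  · intro h
    rw [← h] at h1
    exact (represents_embH φ β z).exists_sub_eq h1
  · rintro ⟨w, hw⟩
    exact ((represents_embH φ β z).congr_of_sub_eq hw).unique h1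

theorem isControlOp_iff (φ : SchurFunction U Y) (β : CPlus) (B' : Y →L[ℂ] HdcNeg φ β) :
    IsControlOp (nodeC φ).adjoint (embH φ β) (adjExt φ β) B' ↔ B' = ctrlOp φ β := by
  have hext : ∀ p : (nodeC φ).adjoint.domain, embH φ β ((nodeC φ).adjoint p).fst
      = adjExt φ β (p : WithLp 2 (Hc φ × Y)).fst
        + ctrlOp φ β (p : WithLp 2 (Hc φ × Y)).snd := fun p =>
    (adjExt_add_ctrlOp_eq_iff φ β _ _ _).2
      ⟨((nodeC φ).adjoint p).snd, (nodeC φ).adjoint.mem_graph p⟩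
  have hdom : ∀ (x : Hc φ) (y : Y), WithLp.toLp 2 (x, y) ∈ (nodeC φ).adjoint.domain ↔
      adjExt φ β x + ctrlOp φ β y ∈ Set.range (embH φ β) := by
    intro x y
    rw [LinearPMap.mem_domain_iff]
    constructor
    · rintro ⟨q, hq⟩
      exact ⟨q.fst, (adjExt_add_ctrlOp_eq_iff φ β x q.fst y).2 ⟨q.snd, hq⟩⟩
    · rintro ⟨z, hz⟩
      obtain ⟨w, hw⟩ := (adjExt_add_ctrlOp_eq_iff φ β x z y).1 hz
      exact ⟨_, hw⟩
  constructor
  · intro h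
    ext1 y
    -- the difference quotient of `φ̃ y` is a first component completing `y` to the domain
    obtain ⟨p, hp⟩ : ∃ p : (nodeC φ).adjoint.domain,
        (p : WithLp 2 (Hc φ × Y)).snd = y := by
      refine ⟨⟨WithLp.toLp 2 (dqTilde φ β.bar y, y), LinearPMap.mem_domain_iff.2
        ⟨WithLp.toLp 2 ((β.bar : ℂ) • dqTilde φ β.bar y, φ.tilde β.bar y),
          (mem_graph_adjoint_nodeC_iff φ _ _ _ _).2 fun μ => ?_⟩⟩, rfl⟩
      have h1 := isDiffQuot_dqTilde φ β.bar y μ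
      rw [sub_smul, ← sub_eq_zero] at h1
      rw [RKHS.coe_smul, Pi.smul_apply, ← sub_eq_zero, ← neg_eq_zero, ← h1]
      abel
    have h2 := h.extend p
    rw [hext p, hp] at h2
    exact (add_left_cancel h2).symm
  · rintro rfl
    exact ⟨hext, hdom⟩

/-- The pairing with pivot space `H_c` is computed by `W`, since
`⟪z, (β - A_c)⁻¹ v⟫ = ⟪(conj β - A_c^*)⁻¹ z, v⟫ = ⟪W (ι z), v⟫`, where `W` is `dqEquiv`. -/
theorem tendsto_inner_resolventA {φ : SchurFunction U Y} {β : CPlus} {e : HdcNeg φ β}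
    {z : ℕ → Hc φ} (hz : Tendsto (fun n => embH φ β (z n)) atTop (𝓝 e)) (v : Hc φ) :
    Tendsto (fun n => ⟪z n, resolventA φ β v⟫_ℂ) atTop (𝓝 ⟪dqEquiv φ β e, v⟫_ℂ) := by
  have h1 := (((dqEquiv φ β).continuous.tendsto e).comp hz).inner (𝕜 := ℂ)
    (tendsto_const_nhds (x := v))
  refine h1.congr fun n => ?_
  rw [Function.comp_apply, dqEquiv_embH, dqH, CPlus.bar_bar,
    ContinuousLinearMap.adjoint_inner_left]

theorem inner_dqTilde_bar (φ : SchurFunction U Y) (β : CPlus) (y : Y) (v : Hc φ) :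
    ⟪dqTilde φ β.bar y, v⟫_ℂ = ⟪y, obsResolvent φ β v⟫_ℂ := by
  rw [dqTilde, CPlus.bar_bar, ContinuousLinearMap.adjoint_inner_left]

/-- Every element of `dom C_c = dom A_c` is of the form `(l - A_c)⁻¹ v`, and `C_c` takes the value
`C_c (l - A_c)⁻¹ v` there. -/
theorem exists_resolventA_eq (φ : SchurFunction U Y) (l : CPlus) (x : (opC φ).domain) :
    ∃ v : Hc φ, resolventA φ l v = x ∧ obsResolvent φ l v = opC φ x := by
  let p : zeroInput φ := ⟨_, opA_opC_mem_nodeGraph φ x.2 x.2, rfl⟩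
  exact ⟨subMainOp φ l p, resolventA_subMainOp φ l p, obsResolvent_subMainOp φ l p⟩

theorem resolventA_mem_domain (φ : SchurFunction U Y) (l : CPlus) (v : Hc φ) :
    ∃ hx : resolventA φ l v ∈ (opC φ).domain, opC φ ⟨_, hx⟩ = obsResolvent φ l v := by
  obtain ⟨p, rfl⟩ := exists_subMainOp_eq φ l v
  rw [resolventA_subMainOp, obsResolvent_subMainOp]
  have hp := p.2.1
  have h1 : (WithLp.toLp 2 (p.1.1.fst, (0 : U)), p.1.2) ∈ nodeGraph φ := by
    rw [← zeroInput_fst]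
    exact hp
  have hx : p.1.1.fst ∈ (opC φ).domain := mem_domain_opA_of_mem φ h1
  refine ⟨hx, ?_⟩
  have h2 := nodeGraph_functional φ _ (sub_mem (opA_opC_mem_nodeGraph φ hx hx) h1) (sub_self _)
  exact congrArg WithLp.snd (sub_eq_zero.1 h2)

theorem isPivotAdjoint_iff (φ : SchurFunction U Y) (β : CPlus) (B' : Y →L[ℂ] HdcNeg φ β) :
    IsPivotAdjoint (opC φ) (embH φ β) B' ↔ B' = ctrlOp φ β := by
  constructor
  · intro h
    ext1 y
    refine (dqEquiv φ β).injective (ext_inner_right ℂ fun v => ?_)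
    rw [dqEquiv_ctrlOp, inner_dqTilde_bar]
    obtain ⟨hx, hv⟩ := resolventA_mem_domain φ β v
    obtain ⟨f, hf, hlim⟩ := mem_closure_iff_seq_limit.1 (denseRange_embH φ β (B' y))
    choose z hz using hf
    obtain rfl : (fun n => embH φ β (z n)) = f := funext hz
    have h1 := h y ⟨_, hx⟩ z hlim
    rw [hv] at h1
    exact tendsto_nhds_unique (tendsto_inner_resolventA hlim v) h1
  · rintro rfl y x z hz
    obtain ⟨v, hv, hC⟩ := exists_resolventA_eq φ β x
    have h1 := tendsto_inner_resolventA hz v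
    rwa [dqEquiv_ctrlOp, inner_dqTilde_bar, hv, hC] at h1

end DeBranges

theorem theorem4p7 {U Y : Type*}
    [NormedAddCommGroup U] [InnerProductSpace ℂ U] [CompleteSpace U]
    [TopologicalSpace.SeparableSpace U]
    [NormedAddCommGroup Y] [InnerProductSpace ℂ Y] [CompleteSpace Y]
    [TopologicalSpace.SeparableSpace Y]
    (φ : DeBranges.SchurFunction U Y) (β : DeBranges.CPlus) :
    -- the concrete space `H^d_{c,-1}` is complete
    CompleteSpace (DeBranges.HdcNeg φ β) ∧
    ∃ (ι Aext : DeBranges.Hc φ →L[ℂ] DeBranges.HdcNeg φ β) (B : Y →L[ℂ] DeBranges.HdcNeg φ β),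
      -- 1. `ι z = [z]` embeds `H_c` densely
      (∀ z : DeBranges.Hc φ, DeBranges.Represents (fun μ => z μ) (ι z)) ∧
      Function.Injective ι ∧
      DenseRange ι ∧
      -- the norm restricted to `H_c` is the norm `‖(conj β - A_c^*)⁻¹ z‖`
      (∃ R : DeBranges.Hc φ →L[ℂ] DeBranges.Hc φ,
        DeBranges.IsResolventAt (DeBranges.opA φ).adjoint (conj (β : ℂ)) R ∧
        ∀ z, ‖ι z‖ = ‖R z‖) ∧
      -- `[x]` lies in `ι(H_c)` iff some / every difference quotient of `x` lies in `dom A_c^*`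
      (∀ (x : DeBranges.CPlus → U) (e : DeBranges.HdcNeg φ β), DeBranges.Represents x e →
        (∀ α : DeBranges.CPlus, ∃ w : DeBranges.Hc φ, DeBranges.IsDiffQuot φ α.bar x w) ∧
        (e ∈ Set.range ι ↔ ∃ (α : DeBranges.CPlus) (w : DeBranges.Hc φ),
          DeBranges.IsDiffQuot φ α.bar x w ∧ w ∈ (DeBranges.opA φ).adjoint.domain) ∧
        (e ∈ Set.range ι ↔ ∀ α : DeBranges.CPlus, ∃ w : DeBranges.Hc φ,
          DeBranges.IsDiffQuot φ α.bar x w ∧ w ∈ (DeBranges.opA φ).adjoint.domain)) ∧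
      -- the representative in `H_c` is the unique one that decays at infinity
      (∀ z : DeBranges.Hc φ, DeBranges.DecaysAtInfinity (fun μ => z μ) ∧
        ∀ x : DeBranges.CPlus → U, DeBranges.Represents x (ι z) →
          DeBranges.DecaysAtInfinity x → x = fun μ => z μ) ∧
      -- 2. `A_c^*|_{H_c} x = [μ ↦ μ x(μ)]` is the unique continuous extension of `A_c^*`
      (∀ x : DeBranges.Hc φ, DeBranges.Represents (fun μ => (μ : ℂ) • x μ) (Aext x)) ∧
      (∀ x : (DeBranges.opA φ).adjoint.domain,
        Aext (x : DeBranges.Hc φ) = ι ((DeBranges.opA φ).adjoint x)) ∧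
      (∀ T : DeBranges.Hc φ →L[ℂ] DeBranges.HdcNeg φ β,
        (∀ x : (DeBranges.opA φ).adjoint.domain,
          T (x : DeBranges.Hc φ) = ι ((DeBranges.opA φ).adjoint x)) → T = Aext) ∧
      -- its resolvent is given by difference quotients
      (∀ α : DeBranges.CPlus, ∃ R : DeBranges.HdcNeg φ β →L[ℂ] DeBranges.Hc φ,
        (∀ e, conj (α : ℂ) • ι (R e) - Aext (R e) = e) ∧
        (∀ x, R (conj (α : ℂ) • ι x - Aext x) = x) ∧
        ∀ (x : DeBranges.CPlus → U) (e : DeBranges.HdcNeg φ β), DeBranges.Represents x e →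
          DeBranges.IsDiffQuot φ α.bar x (R e)) ∧
      -- and it is unitary at `conj β`
      (∃ W : DeBranges.HdcNeg φ β ≃ₗᵢ[ℂ] DeBranges.Hc φ,
        ∀ x, W.symm x = conj (β : ℂ) • ι x - Aext x) ∧
      -- 3. `C_c^* y = [μ ↦ φ̃(μ) y]` is the control operator of the dual system node, and the
      -- adjoint of `C_c` with pivot space `H_c`
      (∀ y : Y, DeBranges.Represents (fun μ => φ.tilde μ y) (B y)) ∧
      (∀ B' : Y →L[ℂ] DeBranges.HdcNeg φ β,
        DeBranges.IsControlOp (DeBranges.nodeC φ).adjoint ι Aext B' ↔ B' = B) ∧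
      (∀ B' : Y →L[ℂ] DeBranges.HdcNeg φ β,
        DeBranges.IsPivotAdjoint (DeBranges.opC φ) ι B' ↔ B' = B) := by
  open DeBranges in
  refine ⟨completeSpace_HdcNeg φ β, embH φ β, adjExt φ β, ctrlOp φ β, represents_embH φ β,
    embH_injective φ β, denseRange_embH φ β,
    ⟨dqH φ β.bar, isResolventAt_dqH φ β.bar, norm_embH φ β⟩, ?_, ?_, represents_adjExt φ β,
    adjExt_eq φ β, ?_, ?_, ⟨dqEquiv φ β, ?_⟩, represents_ctrlOp φ β, isControlOp_iff φ β,
    isPivotAdjoint_iff φ β⟩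
  · intro x e hx
    refine ⟨fun α => ⟨_, isDiffQuot_dqExt α.bar hx⟩, ⟨fun he => ?_, ?_⟩, ⟨fun he α => ?_, ?_⟩⟩
    · exact ⟨β, _, isDiffQuot_dqExt β.bar hx, ((isDiffQuot_dqExt β.bar hx).mem_domain_iff hx).2 he⟩
    · rintro ⟨α, w, hw, hd⟩
      exact (hw.mem_domain_iff hx).1 hd
    · exact ⟨_, isDiffQuot_dqExt α.bar hx, ((isDiffQuot_dqExt α.bar hx).mem_domain_iff hx).2 he⟩
    · intro h
      obtain ⟨w, hw, hd⟩ := h β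
      exact (hw.mem_domain_iff hx).1 hd
  · refine fun z => ⟨decaysAtInfinity_coe z, fun x hx hdec => ?_⟩
    obtain ⟨v, hv⟩ := (represents_embH φ β z).exists_sub_eq hx
    have hv0 : v = 0 := hdec.eq_zero_of_forall_sub_eq (decaysAtInfinity_coe z) fun μ => by
      rw [hv, add_sub_cancel_left]
    funext μ
    rw [hv, hv0, add_zero]
  · intro T hT
    refine ContinuousLinearMap.coeFn_injective
      (Continuous.ext_on (dense_domain_adjoint_opA φ) T.continuous (adjExt φ β).continuous ?_)
    intro x hx
    exact (hT ⟨x, hx⟩).trans (adjExt_eq φ β ⟨x, hx⟩).symm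
  · intro α
    have hrep : ∀ x : Hc φ, Represents (fun μ : CPlus => ((α.bar : ℂ) - μ) • x μ)
        (conj (α : ℂ) • embH φ β x - adjExt φ β x) := by
      intro x
      have h := ((represents_embH φ β x).smul (conj (α : ℂ))).sub (represents_adjExt φ β x)
      simpa only [sub_smul, CPlus.coe_bar] using h
    refine ⟨dqExt φ β α.bar, fun e => ?_, fun x => ?_, fun x e hx => isDiffQuot_dqExt α.bar hx⟩
    · obtain ⟨x, hx⟩ := Represents.exists e
      refine (hrep _).unique (hx.congr_of_sub_eq (v := -x α.bar) fun μ => ?_)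
      rw [isDiffQuot_dqExt α.bar hx μ, sub_eq_add_neg]
    · exact (isDiffQuot_dqExt α.bar (hrep x)).unique (isDiffQuot_sub_smul φ α.bar x)
  · intro x
    rw [adjExt_apply, CPlus.coe_bar, sub_sub_cancel]
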